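/- Lemma 5.3 (le:upper, upper estimates). Let $n\ge 2$ and let $\Omega\subset\mathbb R^n$ be a domain satisfying the exterior ball condition with radius $r_e>0$: for every $\zeta\in\partial\Omega$ there is $\eta^e\in\mathbb R^n\setminus\Omega$ with $B(\eta^e,r_e)\subset\mathbb R^n\setminus\Omega$ and $\partial B(\eta^e,r_e)\cap\partial\Omega=\{\zeta\}$. Let $w\in\partial\Omega$ and $0<r<r_e$. Let $p$ be a Lipschitz continuous variable exponent on $\Omega$ with $$1<p^-:=\operatorname*{ess\,inf}_\Omega p\le p^+:=\operatorname*{ess\,sup}_\Omega p<\infty,$$ and write $\|\nabla p\|_{L^\infty}$ for $\|\nabla p\|_{L^\infty(\Omega)}$. Let $u$ be a positive $p(\cdot)$-harmonic function in $\Omega\cap B(w,r)$, i.e. a positive continuous function in $W^{1,p(\cdot)}_{loc}(\Omega\cap B(w,r))$ with $$\int_{\Omega\cap B(w,r)}|\nabla u|^{p(x)-2}\nabla u\cdot\nabla\phi\,dx=0\qquad\text{for all }\phi\in C_0^\infty(\Omega\cap B(w,r)),$$ and assume that $u$ is continuous on $\overline\Omega\cap B(w,r)$ with $u=0$ on $\partial\Omega\cap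 B(w,r)$. Then there exist constants $c>0$ and $\tilde c>2$ such that, with $\tilde r=r/\tilde c$, one has $\sup_{B(w,2\tilde r)\cap\Omega}u<\infty$ and $$u(x)\le c\,\frac{d(x,\partial\Omega)}{r}\qquad\text{for all }x\in\Omega\cap B(w,\tilde r).$$ The constant $\tilde c$ depends only on $r_e$, $p^-$ and $\|\nabla p\|_{L^\infty}$ (in particular not on $n$, $p^+$, $u$, $w$, $r$), and the constant $c$ depends only on $\sup_{B(w,2\tilde r)\cap\Omega}u$, $r_e$, $n$, $p^+$, $p^-$ and $\|\nabla p\|_{L^\infty}$. The constants can be chosen uniformly: they may be taken to depend only on a lower bound $>1$ for $p^-$ and on upper bounds for $p^+$, $\|\nabla p\|_{L^\infty}$ and $\sup_{B(w,2\tilde r)\cap\Omega}u$ (besides $r_e$ and, for $c$, also $n$). -/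

import Mathlib

open MeasureTheory Metric
open scoped ENNReal ContDiff

namespace VarExp

/-- Euclidean space `ℝⁿ`. -/
abbrev E (n : ℕ) : Type := EuclideanSpace ℝ (Fin n)

/-- A domain: a nonempty, open, connected set. -/
structure IsDomainSet {n : ℕ} (Ω : Set (E n)) : Prop where
  isOpen : IsOpen Ω
  isConnected : IsConnected Ω

/-- The exterior ball condition with radius `re`. -/
def ExteriorBallCondition {n : ℕ} (Ω : Set (E n)) (re : ℝ) : Prop :=
  ∀ w ∈ frontier Ω, ∃ η ∈ Ωᶜ, ball η re ⊆ Ωᶜ ∧ sphere η re ∩ frontier Ω = {w}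

/-- `p` is a variable exponent on `Ω` with `1 < p⁻ ≤ p ≤ p⁺ < ∞` a.e. in `Ω`
and `p` is Lipschitz continuous on `Ω`. Only the values of `p` in `Ω` matter. -/
structure IsBoundedLipschitzExponent {n : ℕ} (Ω : Set (E n)) (p : E n → ℝ) : Prop where
  lipschitz : ∃ K, LipschitzOnWith K p Ω
  bounded : ∃ a b : ℝ, 1 < a ∧ ∀ᵐ x ∂(volume.restrict Ω), a ≤ p x ∧ p x ≤ b

/-- `p⁻ = ess inf_Ω p`. -/
noncomputable def pMinus {n : ℕ} (Ω : Set (E n)) (p : E n → ℝ) : ℝ :=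
  essInf p (volume.restrict Ω)

/-- `p⁺ = ess sup_Ω p`. -/
noncomputable def pPlus {n : ℕ} (Ω : Set (E n)) (p : E n → ℝ) : ℝ :=
  essSup p (volume.restrict Ω)

/-- `‖∇p‖_{L^∞(Ω)}`; the gradient of a Lipschitz function on the open set `Ω` exists a.e. in `Ω`. -/
noncomputable def gradNorm {n : ℕ} (Ω : Set (E n)) (p : E n → ℝ) : ℝ≥0∞ :=
  eLpNorm (fun x => gradient p x) ⊤ (volume.restrict Ω)

/-- The modular `∫_A |f(x)|^{p(x)} dx`. -/
noncomputable def modular {n : ℕ} {F : Type*} [NormedAddCommGroup F]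
    (p : E n → ℝ) (A : Set (E n)) (f : E n → F) : ℝ≥0∞ :=
  ∫⁻ x in A, ENNReal.ofReal (‖f x‖ ^ p x)

/-- The variable exponent Lebesgue space `L^{p(·)}(A)`: measurable functions `f` for which the
modular of `f / μ` is finite for some `μ > 0`. -/
def MemLpVar {n : ℕ} {F : Type*} [NormedAddCommGroup F] [NormedSpace ℝ F]
    (p : E n → ℝ) (A : Set (E n)) (f : E n → F) : Prop :=
  AEStronglyMeasurable f (volume.restrict A) ∧
    ∃ μ : ℝ, 0 < μ ∧ modular p A (fun x => μ⁻¹ • f x) < ⊤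

/-- `φ ∈ C₀^∞(U)`. -/
structure IsTestFunction {n : ℕ} (U : Set (E n)) (φ : E n → ℝ) : Prop where
  smooth : ContDiff ℝ ∞ φ
  compact : HasCompactSupport φ
  support : tsupport φ ⊆ U

/-- `G` is the distributional gradient of `u` in the open set `U`. -/
structure IsWeakGradient {n : ℕ} (U : Set (E n)) (u : E n → ℝ) (G : E n → E n) : Prop where
  locInt : LocallyIntegrableOn u U
  locIntGrad : LocallyIntegrableOn G U
  byParts : ∀ φ : E n → ℝ, IsTestFunction U φ →
    ∫ x in U, u x • gradient φ x = - ∫ x in U, φ x • G x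

/-- `u ∈ W^{1,p(·)}_loc(U)` with distributional gradient `G`. -/
structure IsSobolevLoc {n : ℕ} (p : E n → ℝ) (U : Set (E n))
    (u : E n → ℝ) (G : E n → E n) : Prop where
  weakGradient : IsWeakGradient U u G
  memLp : ∀ K : Set (E n), IsCompact K → K ⊆ U → MemLpVar p K u ∧ MemLpVar p K G

/-- `u ∈ W^{1,p(·)}_loc(U)` is a weak solution of `div(|∇u|^{p(x)-2} ∇u) = 0` in `U`. -/
def IsWeakSolution {n : ℕ} (p : E n → ℝ) (U : Set (E n)) (u : E n → ℝ) : Prop :=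
  ∃ G : E n → E n, IsSobolevLoc p U u G ∧
    ∀ φ : E n → ℝ, IsTestFunction U φ →
      ∫ x in U, ‖G x‖ ^ (p x - 2) * inner ℝ (G x) (gradient φ x) = 0

/-- A `p(·)`-harmonic function in `U`: a continuous weak solution. -/
structure IsPHarmonic {n : ℕ} (p : E n → ℝ) (U : Set (E n)) (u : E n → ℝ) : Prop where
  continuousOn : ContinuousOn u U
  weakSolution : IsWeakSolution p U u

end VarExp

/-! Compare `u` with an explicit radial barrier. If `x` lies within `a` of the boundary, where `a`
is a small multiple of `r`, take a nearest boundary point and an exterior ball `B(η, a)` touching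
there. In the shell `a ≤ |x - η| ≤ 2a` the function `V = B (1 - exp (-K (|x - η|² / a² - 1)))`
vanishes on the inner sphere, is at least `B/2 > sup u` on the outer one, and has slope of order
`BK/a`. So `u ≤ V` gives `u x ≤ 3BK d/a`. If `d ≥ a`, the bound on `u` suffices.

`V` is a supersolution for large `K` (`radial_inequality`, `barrier_supersolution`). Differentiating
`|∇V|^(p-2)` yields the extra term `log |∇V| ∇p · (x - η)`, whose logarithm also grows linearly in
`K`. Only smallness of `a L` against `p⁻ - 1` absorbs that part, which is why `ct` depends on `re`,
`p⁻` and `L` alone.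

The comparison principle (`IsWeakSolution.le_add_of_isCompact`) has to use smooth test functions, so
`u` is replaced by mollifications `v j`. The Lipschitz exponent keeps `|∇v j|^p` below a convergent
integrable majorant (`norm_mollify_rpow_le`), and a dominated convergence theorem with moving
majorants passes to the limit. Strict monotonicity of `ξ ↦ |ξ|^(p-2) ξ` concludes. -/

namespace VarExp

open Filter Topology
open scoped Convolution

/-! ### Convergence of integrals -/

/-- Fatou's lemma for real integrals: the limit integral is eventually almost attained. -/
lemma eventually_lt_integral_of_lt {α : Type*} [MeasurableSpace α] {μ : Measure α}
    {h : ℕ → α → ℝ} {h₀ : α → ℝ} (hi : ∀ j, Integrable (h j) μ) (hi₀ : Integrable h₀ μ)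
    (hpos : ∀ j, 0 ≤ᵐ[μ] h j) (hpos₀ : 0 ≤ᵐ[μ] h₀)
    (hlim : ∀ᵐ x ∂μ, Tendsto (fun j => h j x) atTop (𝓝 (h₀ x))) {c : ℝ} (hc : c < ∫ x, h₀ x ∂μ) :
    ∀ᶠ j in atTop, c < ∫ x, h j x ∂μ := by
  have h1 : ∫⁻ x, ENNReal.ofReal (h₀ x) ∂μ ≤
      liminf (fun j => ∫⁻ x, ENNReal.ofReal (h j x) ∂μ) atTop := by
    calc ∫⁻ x, ENNReal.ofReal (h₀ x) ∂μ
        = ∫⁻ x, liminf (fun j => ENNReal.ofReal (h j x)) atTop ∂μ := by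
          refine lintegral_congr_ae ?_
          filter_upwards [hlim] with x hx
          exact ((ENNReal.continuous_ofReal.tendsto _).comp hx).liminf_eq.symm
      _ ≤ _ := lintegral_liminf_le' fun j => (hi j).aemeasurable.ennreal_ofReal
  rw [← ofReal_integral_eq_lintegral_ofReal hi₀ hpos₀] at h1
  -- `ENNReal.ofReal` sends negative levels to 0, so they are handled by nonnegativity of the
  -- integrals.
  by_cases hc0 : c < 0
  · exact Eventually.of_forall fun j => hc0.trans_le (integral_nonneg_of_ae (hpos j))
  have h2 : ENNReal.ofReal c < liminf (fun j => ∫⁻ x, ENNReal.ofReal (h j x) ∂μ) atTop :=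
    lt_of_lt_of_le ((ENNReal.ofReal_lt_ofReal_iff (lt_of_le_of_lt (not_lt.1 hc0) hc)).2 hc) h1
  filter_upwards [eventually_lt_of_lt_liminf h2] with j hj
  rw [← ofReal_integral_eq_lintegral_ofReal (hi j) (hpos j)] at hj
  exact (ENNReal.ofReal_lt_ofReal_iff_of_nonneg (not_lt.1 hc0)).1 hj

/-- Dominated convergence with a convergent sequence of bounds. -/
lemma tendsto_integral_of_tendsto_bound {α : Type*} [MeasurableSpace α] {μ : Measure α}
    {F g : ℕ → α → ℝ} {f g₀ : α → ℝ} (hF : ∀ j, AEStronglyMeasurable (F j) μ)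
    (hg : ∀ j, Integrable (g j) μ) (hg₀ : Integrable g₀ μ)
    (hle : ∀ j, ∀ᵐ x ∂μ, |F j x| ≤ g j x)
    (hlim : ∀ᵐ x ∂μ, Tendsto (fun j => F j x) atTop (𝓝 (f x)))
    (hglim : ∀ᵐ x ∂μ, Tendsto (fun j => g j x) atTop (𝓝 (g₀ x)))
    (hint : Tendsto (fun j => ∫ x, g j x ∂μ) atTop (𝓝 (∫ x, g₀ x ∂μ))) :
    Integrable f μ ∧ Tendsto (fun j => ∫ x, F j x ∂μ) atTop (𝓝 (∫ x, f x ∂μ)) := by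
  have hFi : ∀ j, Integrable (F j) μ := fun j => (hg j).mono' (hF j) (hle j)
  have hfle : ∀ᵐ x ∂μ, |f x| ≤ g₀ x := by
    filter_upwards [hlim, hglim, ae_all_iff.2 hle] with x h1 h2 h3
    exact le_of_tendsto_of_tendsto' h1.abs h2 h3
  have hfm : AEStronglyMeasurable f μ := aestronglyMeasurable_of_tendsto_ae atTop hF hlim
  have hfi : Integrable f μ := hg₀.mono' hfm hfle
  refine ⟨hfi, ?_⟩
  rw [Metric.tendsto_atTop'] at *
  intro ε hε
  -- Fatou for `g j - F j` bounds `∫ F j` from above, and for `g j + F j` from below.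
  have up := eventually_lt_integral_of_lt (μ := μ) (h := fun j x => g j x - F j x)
    (h₀ := fun x => g₀ x - f x) (fun j => (hg j).sub (hFi j)) (hg₀.sub hfi)
    (fun j => by filter_upwards [hle j] with x hx; simpa using (le_abs_self _).trans hx)
    (by filter_upwards [hfle] with x hx; simpa using (le_abs_self _).trans hx)
    (by filter_upwards [hlim, hglim] with x h1 h2 using h2.sub h1)
    (c := (∫ x, g₀ x - f x ∂μ) - ε / 2) (by linarith)
  have lo := eventually_lt_integral_of_lt (μ := μ) (h := fun j x => g j x + F j x)
    (h₀ := fun x => g₀ x + f x) (fun j => (hg j).add (hFi j)) (hg₀.add hfi)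
    (fun j => by filter_upwards [hle j] with x hx; simp; linarith [(abs_le.1 hx).1])
    (by filter_upwards [hfle] with x hx; simp; linarith [(abs_le.1 hx).1])
    (by filter_upwards [hlim, hglim] with x h1 h2 using h2.add h1)
    (c := (∫ x, g₀ x + f x ∂μ) - ε / 2) (by linarith)
  obtain ⟨N, hN⟩ := hint (ε / 2) (by linarith)
  obtain ⟨N', hN'⟩ := eventually_atTop.1 (up.and lo)
  refine ⟨max N N', fun j hj => ?_⟩
  have h1 := hN j (lt_of_le_of_lt (le_max_left _ _) hj)
  obtain ⟨h2, h3⟩ := hN' j ((le_max_right N N').trans hj.le)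
  rw [integral_sub (hg j) (hFi j), integral_sub hg₀ hfi] at h2
  rw [integral_add (hg j) (hFi j), integral_add hg₀ hfi] at h3
  rw [Real.dist_eq, abs_lt] at *
  constructor <;> linarith [h1.1, h1.2]

/-! ### Inequalities for powers -/

/-- Strict monotonicity of `a ↦ ‖a‖ ^ (p - 2) • a`. -/
lemma inner_rpow_smul_sub_nonneg {F : Type*} [NormedAddCommGroup F] [InnerProductSpace ℝ F]
    {p : ℝ} (hp : 1 < p) (a b : F) :
    0 ≤ ‖a‖ ^ (p - 2) * inner ℝ a (a - b) - ‖b‖ ^ (p - 2) * inner ℝ b (a - b) ∧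
    (‖a‖ ^ (p - 2) * inner ℝ a (a - b) - ‖b‖ ^ (p - 2) * inner ℝ b (a - b) = 0 → a = b) := by
  have key : ∀ c : F, ‖c‖ ^ (p - 2) * ‖c‖ = ‖c‖ ^ (p - 1) := by
    intro c
    rcases eq_or_ne c 0 with rfl | hc
    · simp [Real.zero_rpow (sub_ne_zero.2 hp.ne')]
    · rw [← Real.rpow_add_one (norm_ne_zero_iff.2 hc)]; congr 1; ring
  have hab := real_inner_le_norm a b
  set s := ‖a‖ ^ (p - 2)
  set t := ‖b‖ ^ (p - 2)
  have hs : 0 ≤ s := by positivity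
  have ht : 0 ≤ t := by positivity
  have hst : 0 ≤ (s * ‖a‖ - t * ‖b‖) * (‖a‖ - ‖b‖) := by
    rw [key, key]
    rcases le_total ‖a‖ ‖b‖ with h | h
    · have := Real.rpow_le_rpow (norm_nonneg _) h (sub_nonneg.2 hp.le)
      nlinarith
    · have := Real.rpow_le_rpow (norm_nonneg _) h (sub_nonneg.2 hp.le)
      nlinarith
  -- A radial part and a Cauchy–Schwarz defect, both nonnegative; equality forces equal norms and
  -- equal directions.
  have e : s * inner ℝ a (a - b) - t * inner ℝ b (a - b) =
      (s * ‖a‖ - t * ‖b‖) * (‖a‖ - ‖b‖) + (s + t) * (‖a‖ * ‖b‖ - inner ℝ a b) := by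
    rw [inner_sub_right, inner_sub_right, real_inner_self_eq_norm_sq, real_inner_self_eq_norm_sq,
      real_inner_comm a b]
    ring
  rw [e]
  have h2 : 0 ≤ (s + t) * (‖a‖ * ‖b‖ - inner ℝ a b) :=
    mul_nonneg (by positivity) (by linarith)
  refine ⟨add_nonneg hst h2, fun h => ?_⟩
  have h3 : (s * ‖a‖ - t * ‖b‖) * (‖a‖ - ‖b‖) = 0 := by linarith
  have h4 : (s + t) * (‖a‖ * ‖b‖ - inner ℝ a b) = 0 := by linarith
  have hn : ‖a‖ = ‖b‖ := by
    rcases mul_eq_zero.1 h3 with h5 | h5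
    · rw [key, key] at h5
      exact Real.rpow_left_injOn (sub_ne_zero.2 hp.ne') (norm_nonneg _) (norm_nonneg _)
        (sub_eq_zero.1 h5)
    · linarith
  rcases eq_or_ne a 0 with rfl | ha
  · simpa [eq_comm] using hn.symm
  have hsp : 0 < s := Real.rpow_pos_of_pos (norm_pos_iff.2 ha) _
  have h6 : inner ℝ a b = ‖a‖ * ‖b‖ := by
    rcases mul_eq_zero.1 h4 with h5 | h5 <;> linarith
  have h7 := (inner_eq_norm_mul_iff_real.1 h6)
  rw [hn] at h7
  exact (smul_right_injective F (by rw [← hn]; simpa using ha) h7.symm).symm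

/-- A form of Jensen's inequality for powers. -/
lemma rpow_integral_le {α : Type*} [MeasurableSpace α] {μ : Measure α} {ρ t q : α → ℝ} {m : ℝ}
    (hm : 1 ≤ m) (hρ : ∀ y, 0 ≤ ρ y) (hρi : Integrable ρ μ) (hρ1 : ∫ y, ρ y ∂μ = 1)
    (ht : ∀ y, 0 ≤ t y) (hti : Integrable (fun y => ρ y * t y) μ)
    (hqi : Integrable (fun y => ρ y * q y) μ) (hle : ∀ y, ρ y ≠ 0 → t y ^ m ≤ q y) :
    (∫ y, ρ y * t y ∂μ) ^ m ≤ ∫ y, ρ y * q y ∂μ := by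
  set s := ∫ y, ρ y * t y ∂μ with hs
  have hs0 : 0 ≤ s := integral_nonneg fun y => mul_nonneg (hρ y) (ht y)
  have hq0 : 0 ≤ ∫ y, ρ y * q y ∂μ := by
    refine integral_nonneg fun y => ?_
    by_cases h : ρ y = 0
    · simp [h]
    · exact mul_nonneg (hρ y) ((Real.rpow_nonneg (ht y) _).trans (hle y h))
  rcases hs0.eq_or_lt with h0 | h0
  · rw [← h0, Real.zero_rpow (by linarith)]; exact hq0
  -- The tangent line to `t ^ m` at the mean `s` lies below it (Bernoulli); integrate it against
  -- `ρ`.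
  have : ∫ y, (s ^ m * (1 - m) * ρ y + s ^ m * m / s * (ρ y * t y)) ∂μ ≤ ∫ y, ρ y * q y ∂μ := by
    refine integral_mono ((hρi.const_mul _).add (hti.const_mul _)) hqi fun y => ?_
    by_cases h : ρ y = 0
    · simp [h]
    have hb := one_add_mul_self_le_rpow_one_add (s := t y / s - 1)
      (by linarith [div_nonneg (ht y) hs0]) hm
    have e : t y ^ m = s ^ m * (1 + (t y / s - 1)) ^ m := by
      rw [← Real.mul_rpow hs0 (by simpa using div_nonneg (ht y) hs0)]
      congr 1; field_simp; ring
    have h1 : s ^ m * (1 + m * (t y / s - 1)) ≤ q y :=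
      (mul_le_mul_of_nonneg_left hb (by positivity)).trans (e ▸ hle y h)
    calc s ^ m * (1 - m) * ρ y + s ^ m * m / s * (ρ y * t y)
        = ρ y * (s ^ m * (1 + m * (t y / s - 1))) := by ring
      _ ≤ ρ y * q y := mul_le_mul_of_nonneg_left h1 (hρ y)
  rw [integral_add (hρi.const_mul _) (hti.const_mul _), integral_const_mul, integral_const_mul,
    hρ1, ← hs] at this
  have e : s ^ m * (1 - m) * 1 + s ^ m * m / s * s = s ^ m := by field_simp; ring
  linarith

/-- The power `δ^(-n Kl δ)` stays bounded as `δ → 0` because `-δ log δ ≤ 1`. This absorbs the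
oscillation of the exponent at scale `δ`. -/
lemma rpow_le_const_of_le_div_pow {n : ℕ} {D Kl δ s : ℝ} (hD : 1 ≤ D) (hK : 0 ≤ Kl) (hδ : 0 < δ)
    (hδ1 : δ ≤ 1) (hs : 0 ≤ s) (hsD : s ≤ D / δ ^ n) :
    s ^ (Kl * δ) ≤ Real.exp (Kl * (Real.log D + n)) := by
  refine (Real.rpow_le_rpow hs hsD (by positivity)).trans ?_
  have hpos : 0 < D / δ ^ n := by positivity
  rw [Real.rpow_def_of_pos hpos, Real.exp_le_exp, Real.log_div (by positivity) (by positivity),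
    Real.log_pow]
  have h1 : -Real.log δ ≤ 1 / δ := by
    rw [← Real.log_inv, one_div]
    exact (Real.log_le_sub_one_of_pos (by positivity)).trans (by linarith)
  have h2 : -(δ * Real.log δ) ≤ 1 := by
    calc -(δ * Real.log δ) = δ * -Real.log δ := by ring
      _ ≤ δ * (1 / δ) := by gcongr
      _ = 1 := by field_simp
  have h3 : δ * Real.log D ≤ Real.log D := by
    have := Real.log_nonneg hD
    nlinarith
  have h4 : (n : ℝ) * -(δ * Real.log δ) ≤ n * 1 := by gcongr
  calc (Real.log D - n * Real.log δ) * (Kl * δ)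
      = Kl * (δ * Real.log D + n * -(δ * Real.log δ)) := by ring
    _ ≤ _ := by gcongr; linarith

/-! ### Mollification with a Lipschitz exponent -/

/-- Mollification respects the modular of a Lipschitz exponent. -/
lemma norm_mollify_rpow_le {n : ℕ} {N Kl pm : ℝ} (hK : 0 ≤ Kl) :
    ∃ C : ℝ, 0 ≤ C ∧ ∀ (b : ContDiffBump (0 : E n)) (G : E n → E n) (q p : E n → ℝ) (x : E n),
      b.rOut ≤ 2 * b.rIn → b.rOut ≤ 1 → Kl * b.rOut ≤ pm - 1 → pm ≤ p x → Integrable G →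
      ∫ y, ‖G y‖ ≤ N → Integrable q → (∀ y, 0 ≤ q y) →
      (∀ y ∈ ball x b.rOut, ‖G y‖ ^ p y ≤ q y ∧ |p y - p x| ≤ Kl * b.rOut) →
      ‖(b.normed volume ⋆[ContinuousLinearMap.lsmul ℝ ℝ, volume] G) x‖ ^ p x ≤
        C * (1 + (b.normed volume ⋆[ContinuousLinearMap.lsmul ℝ ℝ, volume] q) x) := by
  set κ := volume.real (ball (0 : E n) 1)
  set D := max 1 (2 ^ n * N / κ)
  refine ⟨Real.exp (Kl * (Real.log D + n)), by positivity, ?_⟩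
  intro b G q p x h2 h1 hKp hpx hG hN hq hq0 hball
  have hκ : 0 < κ := ENNReal.toReal_pos (measure_ball_pos _ _ one_pos).ne' measure_ball_lt_top.ne
  set ρ := b.normed volume with hρ
  have hδ : 0 < b.rOut := b.rOut_pos
  have hρ0 : ∀ y, 0 ≤ ρ y := fun y => b.nonneg_normed y
  have hρle : ∀ y, ρ y ≤ 2 ^ n / (b.rOut ^ n * κ) := by
    intro y
    have := b.normed_le_div_measure_closedBall_rOut volume 2 h2 y
    rw [Measure.real, Measure.addHaar_closedBall _ _ hδ.le, ENNReal.toReal_mul,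
      ENNReal.toReal_ofReal (by positivity)] at this
    simpa [κ, Measure.real] using this
  have hρc : Continuous ρ := b.continuous_normed
  have hGx : Integrable (fun t => G (x - t)) := hG.comp_sub_left x
  have hqx : Integrable (fun t => q (x - t)) := hq.comp_sub_left x
  have hbd : ∀ f : E n → ℝ, Integrable f → Integrable (fun t => ρ t * f t) := fun f hf =>
    hf.bdd_mul hρc.aestronglyMeasurable (c := 2 ^ n / (b.rOut ^ n * κ)) (by
      filter_upwards with t
      rw [Real.norm_of_nonneg (hρ0 t)]; exact hρle t)
  set s := ∫ t, ρ t * ‖G (x - t)‖ with hs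
  have hGs : ‖(ρ ⋆[ContinuousLinearMap.lsmul ℝ ℝ, volume] G) x‖ ≤ s := by
    rw [convolution_def]
    refine (norm_integral_le_integral_norm _).trans (le_of_eq ?_)
    refine integral_congr_ae ?_
    filter_upwards with t
    simp [norm_smul, abs_of_nonneg (hρ0 t)]
  have hs0 : 0 ≤ s := integral_nonneg fun t => mul_nonneg (hρ0 t) (norm_nonneg _)
  have hsD : s ≤ D / b.rOut ^ n := by
    calc s ≤ ∫ t, 2 ^ n / (b.rOut ^ n * κ) * ‖G (x - t)‖ := by
          refine integral_mono (hbd _ hGx.norm) (hGx.norm.const_mul _) fun t => ?_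
          exact mul_le_mul_of_nonneg_right (hρle t) (norm_nonneg _)
      _ = 2 ^ n / (b.rOut ^ n * κ) * ∫ t, ‖G t‖ := by
          rw [integral_const_mul, integral_sub_left_eq_self (fun t => ‖G t‖) volume x]
      _ ≤ 2 ^ n / (b.rOut ^ n * κ) * N := by gcongr
      _ = (2 ^ n * N / κ) / b.rOut ^ n := by field_simp
      _ ≤ _ := by gcongr; exact le_max_right _ _
  have hpow := rpow_le_const_of_le_div_pow (le_max_left _ _) hK hδ h1 hs0 hsD
  have hρi : Integrable ρ := b.integrable_normed
  have hρ1 : ∫ t, ρ t = 1 := b.integral_normed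
  -- Jensen with exponent `p x - Kl δ`, where `δ = b.rOut`. It is at least 1 and at most every `p y`
  -- in the ball, so `‖G y‖` to this power is at most `1 + q y`.
  have hJ := rpow_integral_le (m := p x - Kl * b.rOut) (ρ := ρ) (t := fun t => ‖G (x - t)‖)
    (q := fun t => 1 + q (x - t)) (μ := volume) (by linarith) hρ0 hρi hρ1
    (fun _ => norm_nonneg _) (hbd _ hGx.norm)
    (by simp_rw [mul_add, mul_one]; exact hρi.add (hbd _ hqx)) (by
      intro t ht
      have htb : t ∈ ball (0 : E n) b.rOut := by
        rw [← b.support_normed_eq (μ := volume)]; exact ht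
      obtain ⟨h3, h4⟩ := hball (x - t) (by simpa using htb)
      rcases le_total ‖G (x - t)‖ 1 with h | h
      · exact (Real.rpow_le_one (norm_nonneg _) h (by linarith)).trans
          (by linarith [hq0 (x - t)])
      · refine (Real.rpow_le_rpow_of_exponent_le h ?_).trans (h3.trans (by linarith))
        linarith [(abs_le.1 h4).1])
  have hJe : ∫ t, ρ t * (1 + q (x - t)) =
      1 + (ρ ⋆[ContinuousLinearMap.lsmul ℝ ℝ, volume] q) x := by
    simp_rw [mul_add, mul_one]
    rw [integral_add hρi (hbd _ hqx), hρ1, convolution_def]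
    simp
  rw [hJe] at hJ
  have hp0 : 0 < p x := by nlinarith
  refine (Real.rpow_le_rpow (norm_nonneg _) hGs hp0.le).trans ?_
  rcases hs0.eq_or_lt with h0 | h0
  · rw [← h0, Real.zero_rpow hp0.ne']
    refine mul_nonneg (by positivity) ?_
    rw [← hJe]
    exact integral_nonneg fun t => mul_nonneg (hρ0 t) (by linarith [hq0 (x - t)])
  -- The first factor is bounded since `s ≤ D / δ ^ n`; the second is the Jensen estimate.
  · calc s ^ p x = s ^ (Kl * b.rOut) * s ^ (p x - Kl * b.rOut) := by
          rw [← Real.rpow_add h0]; congr 1; ring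
      _ ≤ _ := mul_le_mul hpow hJ (by positivity) (by positivity)

/-- The gradient of a mollification is the mollification of the weak gradient. -/
lemma gradient_mollify {n : ℕ} {U K : Set (E n)} {u : E n → ℝ} {G : E n → E n}
    (hG : IsWeakGradient U u G) (hK : IsCompact K) (hKU : K ⊆ U) (b : ContDiffBump (0 : E n))
    {x : E n} (hx : closedBall x b.rOut ⊆ K) :
    gradient (b.normed volume ⋆[ContinuousLinearMap.lsmul ℝ ℝ, volume] K.indicator u) x =
      (b.normed volume ⋆[ContinuousLinearMap.lsmul ℝ ℝ, volume] K.indicator G) x := by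
  set ρ := b.normed volume with hρ
  have hui : Integrable (K.indicator u) :=
    (integrable_indicator_iff hK.measurableSet).2 (hG.locInt.integrableOn_compact_subset hKU hK)
  have hρs : ContDiff ℝ ∞ ρ := b.contDiff_normed
  have hρd : Differentiable ℝ ρ := hρs.differentiable (by simp)
  set φ : E n → ℝ := fun y => ρ (x - y) with hφ
  have hφd : ∀ y, HasFDerivAt φ (-(fderiv ℝ ρ (x - y))) y := by
    intro y
    have := (hρd (x - y)).hasFDerivAt.comp y ((hasFDerivAt_id y).const_sub x)
    exact this.congr_fderiv (by ext v; simp)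
  have hsupp : tsupport φ ⊆ closedBall x b.rOut := by
    refine closure_minimal (fun y hy => ?_) isClosed_closedBall
    have : x - y ∈ ball (0 : E n) b.rOut := by
      rw [← b.support_normed_eq (μ := volume)]; exact hy
    rw [mem_ball_zero_iff] at this
    rw [mem_closedBall, dist_comm, dist_eq_norm]
    exact this.le
  have hφt : IsTestFunction U φ :=
    ⟨hρs.comp (contDiff_const.sub contDiff_id),
      HasCompactSupport.of_support_subset_isCompact (isCompact_closedBall x b.rOut)
        ((subset_tsupport _).trans hsupp),
      hsupp.trans (hx.trans hKU)⟩
  have hfd := b.hasCompactSupport_normed.hasFDerivAt_convolution_left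
    (ContinuousLinearMap.lsmul ℝ ℝ) (μ := volume) (hρs.of_le (by simp)) hui.locallyIntegrable x
  have hpar := hφt |> hG.byParts φ
  have hφ0 : ∀ y, y ∉ K → φ y = 0 := fun y hy =>
    image_eq_zero_of_notMem_tsupport fun h => hy (hx (hsupp h))
  have hg0 : ∀ y, y ∉ K → gradient φ y = 0 := by
    intro y hy
    have h1 : fderiv ℝ φ y = 0 :=
      image_eq_zero_of_notMem_tsupport fun h => hy (hx (hsupp (tsupport_fderiv_subset ℝ h)))
    simp [gradient, h1]
  have e1 : ∫ y in U, u y • gradient φ y = ∫ y, K.indicator u y • gradient φ y := by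
    rw [setIntegral_eq_integral_of_forall_compl_eq_zero]
    · refine integral_congr_ae (Eventually.of_forall fun y => ?_)
      by_cases hy : y ∈ K
      · simp [hy]
      · simp [hg0 y hy]
    · intro y hy
      simp [hg0 y fun h => hy (hKU h)]
  have e2 : ∫ y in U, φ y • G y = ∫ y, φ y • K.indicator G y := by
    rw [setIntegral_eq_integral_of_forall_compl_eq_zero]
    · refine integral_congr_ae (Eventually.of_forall fun y => ?_)
      by_cases hy : y ∈ K
      · simp [hy]
      · simp [hφ0 y hy]
    · intro y hy
      simp [hφ0 y fun h => hy (hKU h)]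
  rw [e1, e2] at hpar
  -- The inverse Riesz map is typed as conjugate-linear; as a real linear isometry it commutes with
  -- the integral.
  let T : (E n →L[ℝ] ℝ) →ₗᵢ[ℝ] E n :=
    ⟨⟨⟨(InnerProductSpace.toDual ℝ (E n)).symm, map_add _⟩, fun c f => by simp⟩, fun f => by simp⟩
  rw [gradient, hfd.fderiv, convolution_eq_swap, convolution_eq_swap]
  change T _ = _
  rw [← LinearIsometry.integral_comp_comm]
  have e3 : ∀ y, T (((ContinuousLinearMap.lsmul ℝ ℝ).precompL (E n) (fderiv ℝ ρ (x - y)))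
        (K.indicator u y)) = -(K.indicator u y • gradient φ y) := by
    intro y
    change (InnerProductSpace.toDual ℝ (E n)).symm _ = _
    rw [gradient, (hφd y).fderiv, map_neg, smul_neg, neg_neg, ← map_smul]
    congr 1
    ext v
    simp [mul_comm]
  rw [integral_congr_ae (Eventually.of_forall e3), integral_neg]
  rw [hpar, neg_neg]
  simp [hφ]

/-- Local approximation of a Sobolev function by smooth functions, in the modular sense. -/
lemma exists_smooth_approx {n : ℕ} {U S : Set (E n)} {u : E n → ℝ} {G : E n → E n} {p : E n → ℝ}
    {Kp : NNReal} {pm : ℝ} (hU : IsOpen U) (hS : IsCompact S) (hSU : S ⊆ U)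
    (hu : ContinuousOn u U) (hG : IsWeakGradient U u G) (hp : LipschitzOnWith Kp p U)
    (hpm : 1 < pm) (hpU : ∀ x ∈ U, pm ≤ p x)
    (hGp : ∀ K, IsCompact K → K ⊆ U → IntegrableOn (fun x => ‖G x‖ ^ p x) K) :
    ∃ (v g : ℕ → E n → ℝ) (g₀ : E n → ℝ) (C : ℝ), 0 ≤ C ∧ (∀ j, ContDiff ℝ ∞ (v j)) ∧
      TendstoUniformlyOn v u atTop S ∧
      (∀ᵐ x, x ∈ S → Tendsto (fun j => gradient (v j) x) atTop (𝓝 (G x))) ∧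
      (∀ j, Integrable (g j)) ∧ Integrable g₀ ∧ (∀ j x, 0 ≤ g j x) ∧
      (∀ᵐ x, Tendsto (fun j => g j x) atTop (𝓝 (g₀ x))) ∧
      (∀ j, ∫ x, g j x = ∫ x, g₀ x) ∧
      ∀ j, ∀ x ∈ S, ‖gradient (v j) x‖ ^ p x ≤ C * (1 + g j x) := by
  obtain ⟨δ₁, hδ₁, hδ₁U⟩ := hS.exists_cthickening_subset_open hU hSU
  -- The scale keeps the balls inside `U`, is at most 1, and leaves the Jensen exponent at least 1.
  set δ₀ := min (min δ₁ 1) ((pm - 1) / (Kp + 1)) with hδ₀def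
  have hδ₀ : 0 < δ₀ := lt_min (lt_min hδ₁ one_pos) (div_pos (by linarith) (by positivity))
  have hδ₀1 : δ₀ ≤ 1 := (min_le_left _ _).trans (min_le_right _ _)
  have hKδ : Kp * δ₀ ≤ pm - 1 := by
    have h1 : δ₀ ≤ (pm - 1) / (Kp + 1) := min_le_right _ _
    rw [le_div_iff₀ (by positivity)] at h1
    nlinarith [Kp.coe_nonneg]
  set K := cthickening δ₀ S with hKdef
  have hK : IsCompact K := hS.cthickening
  have hKU : K ⊆ U :=
    (cthickening_mono ((min_le_left _ _).trans (min_le_left _ _)) _).trans hδ₁U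
  set G' := K.indicator G
  set q := K.indicator fun x => ‖G x‖ ^ p x with hq
  have hG'i : Integrable G' :=
    (integrable_indicator_iff hK.measurableSet).2
      (hG.locIntGrad.integrableOn_compact_subset hKU hK)
  have hui : Integrable (K.indicator u) :=
    (integrable_indicator_iff hK.measurableSet).2 (hG.locInt.integrableOn_compact_subset hKU hK)
  have hqi : Integrable q := (integrable_indicator_iff hK.measurableSet).2 (hGp K hK hKU)
  have hq0 : ∀ x, 0 ≤ q x := fun x => Set.indicator_nonneg (fun _ _ => by positivity) x
  obtain ⟨C, hC, hmoll⟩ :=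
    norm_mollify_rpow_le (n := n) (N := ∫ y, ‖G' y‖) (Kl := Kp) (pm := pm) Kp.coe_nonneg
  have hdj : ∀ j : ℕ, 0 < δ₀ / (j + 1) := fun j => by positivity
  -- A fixed ratio of radii bounds the kernels by a multiple of `δ ^ (-n)` and allows Lebesgue
  -- differentiation.
  let b : ℕ → ContDiffBump (0 : E n) := fun j =>
    ⟨δ₀ / (j + 1) / 2, δ₀ / (j + 1), half_pos (hdj j), half_lt_self (hdj j)⟩
  have hbδ : ∀ j, (b j).rOut ≤ δ₀ := fun j => div_le_self hδ₀.le (by simp)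
  have hb2 : ∀ j, (b j).rOut ≤ 2 * (b j).rIn := fun j => by
    change δ₀ / (j + 1) ≤ 2 * (δ₀ / (j + 1) / 2); linarith
  have hblim : Tendsto (fun j => (b j).rOut) atTop (𝓝 0) := by
    have := tendsto_one_div_add_atTop_nhds_zero_nat (𝕜 := ℝ) |>.const_mul δ₀
    simpa [b, div_eq_mul_inv] using this
  have hsub : ∀ j, ∀ x ∈ S, closedBall x (b j).rOut ⊆ K := fun j x hx =>
    (closedBall_subset_closedBall (hbδ j)).trans (closedBall_subset_cthickening hx δ₀)
  have hgrad : ∀ j, ∀ x ∈ S, gradient ((b j).normed volume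
      ⋆[ContinuousLinearMap.lsmul ℝ ℝ, volume] K.indicator u) x =
      ((b j).normed volume ⋆[ContinuousLinearMap.lsmul ℝ ℝ, volume] G') x := fun j x hx =>
    gradient_mollify hG hK hKU (b j) (hsub j x hx)
  refine ⟨fun j => (b j).normed volume ⋆[ContinuousLinearMap.lsmul ℝ ℝ, volume] K.indicator u,
    fun j => (b j).normed volume ⋆[ContinuousLinearMap.lsmul ℝ ℝ, volume] q, q, C, hC,
    fun j => ?_, ?_, ?_, fun j => ?_, hqi, fun j x => ?_, ?_, fun j => ?_, fun j x hx => ?_⟩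
  · exact (b j).hasCompactSupport_normed.contDiff_convolution_left _ (b j).contDiff_normed
      hui.locallyIntegrable
  · have huc : UniformContinuousOn u K :=
      hK.uniformContinuousOn_of_continuous (hu.mono hKU)
    rw [Metric.tendstoUniformlyOn_iff]
    intro ε hε
    obtain ⟨δ, hδ, hδu⟩ := Metric.uniformContinuousOn_iff.1 huc (ε / 2) (half_pos hε)
    filter_upwards [hblim.eventually (gt_mem_nhds hδ)] with j hj x hx
    have hxK : x ∈ K := hsub j x hx (mem_closedBall_self (b j).rOut_pos.le)
    have := (b j).dist_normed_convolution_le (μ := volume) (x₀ := x) (ε := ε / 2)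
      hui.aestronglyMeasurable (by
        intro y hy
        have hyK : y ∈ K := hsub j x hx (ball_subset_closedBall hy)
        rw [Set.indicator_of_mem hyK, Set.indicator_of_mem hxK]
        exact (hδu y hyK x hxK (lt_trans hy hj)).le)
    rw [Set.indicator_of_mem hxK, dist_comm] at this
    exact this.trans_lt (half_lt_self hε)
  · filter_upwards [ContDiffBump.ae_convolution_tendsto_right_of_locallyIntegrable
      (φ := b) (μ := volume) hblim (Eventually.of_forall hb2) hG'i.locallyIntegrable] with x hx hxS
    have hxK : x ∈ K := hsub 0 x hxS (mem_closedBall_self (b 0).rOut_pos.le)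
    rw [show G' x = G x from Set.indicator_of_mem hxK _] at hx
    refine hx.congr fun j => (hgrad j x hxS).symm
  · exact (b j).integrable_normed.integrable_convolution _ hqi
  · exact integral_nonneg fun t => mul_nonneg ((b j).nonneg_normed t) (hq0 _)
  · exact ContDiffBump.ae_convolution_tendsto_right_of_locallyIntegrable
      (φ := b) (μ := volume) hblim (Eventually.of_forall hb2) hqi.locallyIntegrable
  · rw [integral_convolution (ContinuousLinearMap.lsmul ℝ ℝ) (b j).integrable_normed hqi,
      (b j).integral_normed]
    simp
  · rw [hgrad j x hx]
    have hxU := hSU hx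
    refine hmoll (b j) G' q p x (hb2 j) ((hbδ j).trans hδ₀1) ?_ (hpU x hxU) hG'i le_rfl hqi hq0 ?_
    · exact (mul_le_mul_of_nonneg_left (hbδ j) Kp.coe_nonneg).trans hKδ
    · intro y hy
      have hyK : y ∈ K := hsub j x hx (ball_subset_closedBall hy)
      refine ⟨by simp [G', hq, hyK], ?_⟩
      have := hp.dist_le_mul y (hKU hyK) x hxU
      rw [Real.dist_eq] at this
      exact this.trans (mul_le_mul_of_nonneg_left (le_of_lt hy) Kp.coe_nonneg)

/-! ### Cutoffs, Young's inequality and limits of the weak form -/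

lemma inner_gradient_left {n : ℕ} (f : E n → ℝ) (x y : E n) :
    inner ℝ (gradient f x) y = fderiv ℝ f x y := by
  simp [gradient]

lemma continuous_gradient {n : ℕ} {f : E n → ℝ} (hf : ContDiff ℝ ∞ f) :
    Continuous (gradient f) :=
  (InnerProductSpace.toDual ℝ (E n)).symm.continuous.comp (hf.continuous_fderiv (by simp))

/-- Equality with 1 holds near `K`, not merely on it, so the derivative of the cutoff also vanishes
on `K`. -/
lemma exists_cutoff {n : ℕ} {K U : Set (E n)} (hK : IsCompact K) (hU : IsOpen U) (hKU : K ⊆ U) :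
    ∃ χ : E n → ℝ, IsTestFunction U χ ∧ (∀ x, χ x ∈ Set.Icc (0 : ℝ) 1) ∧
      ∀ x ∈ K, χ =ᶠ[𝓝 x] fun _ => 1 := by
  obtain ⟨δ, hδ, hδU⟩ := hK.exists_cthickening_subset_open hU hKU
  have hsub : cthickening (δ / 2) K ⊆ thickening δ K :=
    cthickening_subset_thickening' hδ (half_lt_self hδ) K
  obtain ⟨χ, hχ, hr, hs, h1⟩ := exists_contMDiff_support_eq_eq_one_iff (n := (⊤ : ℕ∞))
    (modelWithCornersSelf ℝ (E n)) (isOpen_thickening (δ := δ) (E := K))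
    (isClosed_cthickening (δ := δ / 2) (E := K)) hsub
  have hts : tsupport χ ⊆ cthickening δ K := by
    rw [tsupport, hs]
    exact closure_thickening_subset_cthickening δ K
  refine ⟨χ, ⟨hχ.contDiff, ?_, hts.trans hδU⟩, fun x => hr ⟨x, rfl⟩, fun x hx => ?_⟩
  · exact HasCompactSupport.of_support_subset_isCompact hK.cthickening
      ((subset_tsupport _).trans hts)
  · have : thickening (δ / 2) K ∈ 𝓝 x :=
      isOpen_thickening.mem_nhds (self_subset_thickening (half_pos hδ) K hx)
    filter_upwards [this] with y hy
    exact (h1 y).1 (thickening_subset_cthickening _ _ hy)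

lemma exists_deriv_smoothTransition_le :
    ∃ C : ℝ, ∀ t, |deriv Real.smoothTransition t| ≤ C := by
  have hc : Continuous (deriv Real.smoothTransition) :=
    (Real.smoothTransition.contDiff (n := 1)).continuous_deriv le_rfl
  have hs : HasCompactSupport (deriv Real.smoothTransition) := by
    refine HasCompactSupport.intro (isCompact_Icc (a := (0 : ℝ)) (b := 1)) fun t ht => ?_
    rw [Set.mem_Icc, not_and_or, not_le, not_le] at ht
    rcases ht with ht | ht
    · have : Real.smoothTransition =ᶠ[𝓝 t] fun _ => 0 := by
        filter_upwards [gt_mem_nhds ht] with s hs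
        exact Real.smoothTransition.zero_of_nonpos hs.le
      rw [this.deriv_eq, deriv_const]
    · have : Real.smoothTransition =ᶠ[𝓝 t] fun _ => 1 := by
        filter_upwards [lt_mem_nhds ht] with s hs
        exact Real.smoothTransition.one_of_one_le hs.le
      rw [this.deriv_eq, deriv_const]
  exact hs.exists_bound_of_continuous hc

/-- Young's inequality in crude form: replace the smaller of `a` and `s` by the larger. -/
lemma rpow_sub_one_mul_le {a s p : ℝ} (ha : 0 ≤ a) (hs : 0 ≤ s) (hp : 1 ≤ p) :
    a ^ (p - 1) * s ≤ a ^ p + s ^ p := by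
  have key : ∀ c : ℝ, 0 ≤ c → c ^ (p - 1) * c = c ^ p := by
    intro c hc
    rcases hc.eq_or_lt with rfl | hc
    · rw [mul_zero, Real.zero_rpow (by linarith)]
    · rw [← Real.rpow_add_one hc.ne']; congr 1; ring
  rcases le_total s a with h | h
  · calc a ^ (p - 1) * s ≤ a ^ (p - 1) * a := by gcongr
      _ ≤ _ := by rw [key a ha]; linarith [Real.rpow_nonneg hs p]
  · calc a ^ (p - 1) * s ≤ s ^ (p - 1) * s := by gcongr
      _ ≤ _ := by rw [key s hs]; linarith [Real.rpow_nonneg ha p]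

lemma norm_rpow_smul_mul_le {F : Type*} [NormedAddCommGroup F] [NormedSpace ℝ F] (a : F)
    {s p : ℝ} (hs : 0 ≤ s) (hp : 1 ≤ p) :
    ‖‖a‖ ^ (p - 2) • a‖ * s ≤ ‖a‖ ^ p + s ^ p := by
  rcases eq_or_ne a 0 with rfl | ha
  · simp only [smul_zero, norm_zero, zero_mul]; positivity
  · have e : ‖‖a‖ ^ (p - 2) • a‖ = ‖a‖ ^ (p - 1) := by
      rw [norm_smul, Real.norm_of_nonneg (by positivity),
        ← Real.rpow_add_one (norm_ne_zero_iff.2 ha)]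
      congr 1; ring
    rw [e]
    exact rpow_sub_one_mul_le (norm_nonneg _) hs hp

/-- Convergence of weighted integrals along vector fields converging in the modular sense. -/
lemma tendsto_integral_inner {n : ℕ} {S : Set (E n)} {p : E n → ℝ} (hS : IsCompact S)
    {Z : ℕ → E n → E n} {G W Y : E n → E n} {g θ : ℕ → E n → ℝ} {g₀ θ₀ h : E n → ℝ}
    {C B Cθ c : ℝ} (hZ : ∀ j, Continuous (Z j)) (hW : Continuous W)
    (hZG : ∀ᵐ x, x ∈ S → Tendsto (fun j => Z j x) atTop (𝓝 (G x)))
    (hgi : ∀ j, Integrable (g j)) (hg₀ : Integrable g₀) (hg0 : ∀ j x, 0 ≤ g j x)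
    (hglim : ∀ᵐ x, Tendsto (fun j => g j x) atTop (𝓝 (g₀ x)))
    (hgint : ∀ j, ∫ x, g j x = ∫ x, g₀ x) (hC : 0 ≤ C)
    (hZp : ∀ j, ∀ x ∈ S, ‖Z j x‖ ^ p x ≤ C * (1 + g j x))
    (hWp : ∀ x ∈ S, ‖W x‖ ^ p x ≤ B)
    (hθ : ∀ j, Continuous (θ j)) (hθle : ∀ j x, |θ j x| ≤ Cθ)
    (hθlim : ∀ x ∈ S, Tendsto (fun j => θ j x) atTop (𝓝 (θ₀ x)))
    (hY : AEStronglyMeasurable Y (volume.restrict S)) (hc : 0 ≤ c) (hh : IntegrableOn h S)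
    (hYle : ∀ x ∈ S, ∀ s, 0 ≤ s → ‖Y x‖ * s ≤ h x + c * s ^ p x) :
    IntegrableOn (fun x => θ₀ x * inner ℝ (Y x) (G x - W x)) S ∧
    Tendsto (fun j => ∫ x in S, θ j x * inner ℝ (Y x) (Z j x - W x)) atTop
      (𝓝 (∫ x in S, θ₀ x * inner ℝ (Y x) (G x - W x))) := by
  have hSm := hS.measurableSet
  have hCθ : 0 ≤ Cθ := (abs_nonneg _).trans (hθle 0 0)
  set H : E n → ℝ := S.indicator fun x => Cθ * (2 * h x + c * B + c * C)
  have hHi : Integrable H := by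
    rw [integrable_indicator_iff hSm]
    have hcst : ∀ t : ℝ, IntegrableOn (fun _ : E n => t) S := fun t =>
      integrableOn_const hS.measure_lt_top.ne
    exact (((hh.const_mul 2).add (hcst _)).add (hcst _)).const_mul Cθ
  have hFm : ∀ j, AEStronglyMeasurable (S.indicator
      fun x => θ j x * inner ℝ (Y x) (Z j x - W x)) volume := by
    intro j
    rw [aestronglyMeasurable_indicator_iff hSm]
    exact (hθ j).aestronglyMeasurable.mul
      (hY.inner ((hZ j).sub hW).aestronglyMeasurable)
  have hle : ∀ j, ∀ᵐ x, |S.indicator (fun x => θ j x * inner ℝ (Y x) (Z j x - W x)) x| ≤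
      H x + Cθ * (c * C) * g j x := by
    intro j
    filter_upwards with x
    by_cases hx : x ∈ S
    · simp only [Set.indicator_of_mem hx, H]
      have h1 : |inner ℝ (Y x) (Z j x - W x)| ≤ 2 * h x + c * B + c * (C * (1 + g j x)) := by
        calc |inner ℝ (Y x) (Z j x - W x)| ≤ ‖Y x‖ * ‖Z j x - W x‖ := abs_real_inner_le_norm _ _
          _ ≤ ‖Y x‖ * (‖Z j x‖ + ‖W x‖) := by gcongr; exact norm_sub_le _ _
          _ = ‖Y x‖ * ‖Z j x‖ + ‖Y x‖ * ‖W x‖ := by ring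
          _ ≤ (h x + c * ‖Z j x‖ ^ p x) + (h x + c * ‖W x‖ ^ p x) :=
            add_le_add (hYle x hx _ (norm_nonneg _)) (hYle x hx _ (norm_nonneg _))
          _ ≤ (h x + c * (C * (1 + g j x))) + (h x + c * B) := by
            gcongr
            · exact hZp j x hx
            · exact hWp x hx
          _ = _ := by ring
      rw [abs_mul]
      calc |θ j x| * |inner ℝ (Y x) (Z j x - W x)|
          ≤ Cθ * (2 * h x + c * B + c * (C * (1 + g j x))) :=
            mul_le_mul (hθle j x) h1 (abs_nonneg _) hCθ
        _ = _ := by ring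
    · simp only [Set.indicator_of_notMem hx, H, abs_zero, zero_add]
      exact mul_nonneg (by positivity) (hg0 j x)
  have hbi : ∀ j, Integrable fun x => H x + Cθ * (c * C) * g j x := fun j =>
    hHi.add ((hgi j).const_mul _)
  -- The majorants move with `j`, but all have the same integral as their limit.
  have key := tendsto_integral_of_tendsto_bound (μ := volume)
    (F := fun j => S.indicator fun x => θ j x * inner ℝ (Y x) (Z j x - W x))
    (g := fun j x => H x + Cθ * (c * C) * g j x) (g₀ := fun x => H x + Cθ * (c * C) * g₀ x)
    (f := S.indicator fun x => θ₀ x * inner ℝ (Y x) (G x - W x)) hFm hbi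
    (hHi.add (hg₀.const_mul _)) hle
    (by
      filter_upwards [hZG] with x hx
      by_cases hxS : x ∈ S
      · simp only [Set.indicator_of_mem hxS]
        exact (hθlim x hxS).mul (tendsto_const_nhds.inner ((hx hxS).sub tendsto_const_nhds))
      · simp [Set.indicator_of_notMem hxS])
    (by filter_upwards [hglim] with x hx using tendsto_const_nhds.add (hx.const_mul _))
    (by
      have : ∀ j, ∫ x, (H x + Cθ * (c * C) * g j x) = ∫ x, (H x + Cθ * (c * C) * g₀ x) := by
        intro j
        rw [integral_add hHi ((hgi j).const_mul _), integral_add hHi (hg₀.const_mul _),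
          integral_const_mul, integral_const_mul, hgint j]
      simp_rw [this]
      exact tendsto_const_nhds)
  refine ⟨(integrable_indicator_iff hSm).1 key.1, ?_⟩
  simpa only [integral_indicator hSm] using key.2

/-- Since the exponent is bounded, undoing the scaling by `μ` costs at most the factor `max 1 μ ^
b`. -/
lemma integrableOn_norm_rpow_of_memLpVar {n : ℕ} {K : Set (E n)} {p : E n → ℝ} {b : ℝ}
    {G : E n → E n} (hK : MeasurableSet K) (hp : ContinuousOn p K)
    (hpb : ∀ x ∈ K, 0 ≤ p x ∧ p x ≤ b) (h : MemLpVar p K G) :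
    IntegrableOn (fun x => ‖G x‖ ^ p x) K := by
  obtain ⟨hm, μ, hμ, hfin⟩ := h
  have hpm : AEMeasurable p (volume.restrict K) := hp.aemeasurable hK
  have h1 : IntegrableOn (fun x => ‖μ⁻¹ • G x‖ ^ p x) K := by
    refine ⟨((hm.const_smul μ⁻¹).norm.aemeasurable.pow hpm).aestronglyMeasurable, ?_⟩
    rw [hasFiniteIntegral_iff_ofReal (Eventually.of_forall fun x => by positivity)]
    exact hfin
  refine (h1.const_mul (max 1 μ ^ b)).mono' (hm.norm.aemeasurable.pow hpm).aestronglyMeasurable ?_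
  filter_upwards [ae_restrict_mem hK] with x hx
  rw [Real.norm_of_nonneg (by positivity)]
  calc ‖G x‖ ^ p x = (μ * ‖μ⁻¹ • G x‖) ^ p x := by
        rw [norm_smul, norm_inv, Real.norm_of_nonneg hμ.le, mul_inv_cancel_left₀ hμ.ne']
    _ = μ ^ p x * ‖μ⁻¹ • G x‖ ^ p x := Real.mul_rpow hμ.le (norm_nonneg _)
    _ ≤ max 1 μ ^ b * ‖μ⁻¹ • G x‖ ^ p x := by
        gcongr
        exact (Real.rpow_le_rpow hμ.le (le_max_right _ _) (hpb x hx).1).trans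
          (Real.rpow_le_rpow_of_exponent_le (le_max_left _ _) (hpb x hx).2)

/-- The integral of a compactly supported function is controlled by its gradient. -/
lemma integral_eq_neg_integral_inner_gradient {n : ℕ} {φ : E n → ℝ} (hφ : ContDiff ℝ ∞ φ)
    (hc : HasCompactSupport φ) {e : E n} (he : ‖e‖ = 1) :
    ∫ x, φ x = -∫ x, inner ℝ (inner ℝ e x • e) (gradient φ x) := by
  have hd : Differentiable ℝ φ := hφ.differentiable (by simp)
  have hl : ∀ x, HasFDerivAt (fun x => inner ℝ e x) (innerSL ℝ e) x := fun x =>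
    (innerSL ℝ e).hasFDerivAt
  have hcf : HasCompactSupport fun x => fderiv ℝ φ x e := hc.fderiv_apply ℝ e
  have hfc : Continuous fun x => fderiv ℝ φ x e :=
    (hφ.continuous_fderiv (by simp)).clm_apply continuous_const
  have hle : Continuous fun x : E n => inner ℝ e x := continuous_const.inner continuous_id
  -- The field `⟨e, x⟩ e` has divergence 1.
  have h := integral_mul_fderiv_eq_neg_fderiv_mul_of_integrable (μ := volume)
    (f := fun x => inner ℝ e x) (g := φ) (v := e)
    (by
      simp only [fun x => (hl x).fderiv]
      exact (continuous_const.mul hφ.continuous).integrable_of_hasCompactSupport hc.mul_left)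
    ((hle.mul hfc).integrable_of_hasCompactSupport hcf.mul_left)
    ((hle.mul hφ.continuous).integrable_of_hasCompactSupport hc.mul_left)
    (fun x _ => (hl x).differentiableAt) (fun x _ => hd x)
  simp only [fun x => (hl x).fderiv, innerSL_apply_apply, real_inner_self_eq_norm_sq, he,
    one_pow, one_mul] at h
  have h2 : ∀ x, inner ℝ (inner ℝ e x • e) (gradient φ x) = inner ℝ e x * fderiv ℝ φ x e := by
    intro x
    rw [real_inner_smul_left, real_inner_comm (gradient φ x) e, inner_gradient_left]
  simp_rw [h2]
  rw [h, neg_neg]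

/-- The alternative `h0` kills the product-rule term containing `∇χ`. -/
lemma gradient_mul_comp_sub {n : ℕ} {χ v V : E n → ℝ} {Ψ : ℝ → ℝ} {d : ℝ} {x : E n}
    (hχ : DifferentiableAt ℝ χ x) (hv : DifferentiableAt ℝ v x) (hV : DifferentiableAt ℝ V x)
    (hΨ : Differentiable ℝ Ψ) (h0 : Ψ (v x - V x - d) = 0 ∨ fderiv ℝ χ x = 0) :
    gradient (fun y => χ y * Ψ (v y - V y - d)) x =
      (χ x * deriv Ψ (v x - V x - d)) • (gradient v x - gradient V x) := by
  refine ext_inner_right ℝ fun y => ?_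
  have h1 : HasFDerivAt (fun y => v y - V y - d) (fderiv ℝ v x - fderiv ℝ V x) x :=
    (hv.hasFDerivAt.sub hV.hasFDerivAt).sub_const d
  have h2 := hχ.hasFDerivAt.mul ((hΨ (v x - V x - d)).hasDerivAt.comp_hasFDerivAt x h1)
  rw [inner_gradient_left, inner_smul_left, inner_sub_left, inner_gradient_left,
    inner_gradient_left]
  have h3 : fderiv ℝ (fun y => χ y * Ψ (v y - V y - d)) x = _ := h2.fderiv
  rw [h3]
  rcases h0 with h0 | h0 <;> simp [h0] <;> ring

/-! ### Comparison principle -/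

/-- Comparison principle: a weak solution lies below a smooth supersolution which dominates it
near the boundary. -/
theorem IsWeakSolution.le_add_of_isCompact {n : ℕ} (hn : 0 < n) {U : Set (E n)}
    {u V p : E n → ℝ} {Kp : NNReal} {pm b c d : ℝ} (hU : IsOpen U)
    (hp : LipschitzOnWith Kp p U) (hpm : 1 < pm) (hpU : ∀ x ∈ U, pm ≤ p x ∧ p x ≤ b)
    (hu : ContinuousOn u U) (hw : IsWeakSolution p U u) (hV : ContDiff ℝ ∞ V)
    (hsuper : ∀ φ, IsTestFunction U φ → (∀ x, 0 ≤ φ x) →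
      0 ≤ ∫ x in U, ‖gradient V x‖ ^ (p x - 2) * inner ℝ (gradient V x) (gradient φ x))
    (hK : IsCompact {x ∈ U | V x + c ≤ u x}) (hcd : c < d) :
    ∀ x ∈ U, u x ≤ V x + d := by
  obtain ⟨G, ⟨hG, hmem⟩, hsol⟩ := hw
  have hpc : ContinuousOn p U := hp.continuousOn
  have hGp : ∀ K, IsCompact K → K ⊆ U → IntegrableOn (fun x => ‖G x‖ ^ p x) K := fun K hK hKU =>
    integrableOn_norm_rpow_of_memLpVar hK.measurableSet (hpc.mono hKU)
      (fun x hx => ⟨by linarith [(hpU x (hKU hx)).1], (hpU x (hKU hx)).2⟩) (hmem K hK hKU).2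
  obtain ⟨χ, hχ, hχ01, hχ1⟩ := exists_cutoff hK hU (Set.sep_subset _ _)
  set S := tsupport χ with hSdef
  have hS : IsCompact S := hχ.compact
  have hSU : S ⊆ U := hχ.support
  have hSm := hS.measurableSet
  have hχS : ∀ x, x ∉ S → χ x = 0 := fun x hx => image_eq_zero_of_notMem_tsupport hx
  obtain ⟨v, g, g₀, C, hC, hv, hvu, hvG, hgi, hg₀, hg0, hglim, hgint, hgle⟩ :=
    exists_smooth_approx hU hS hSU hu hG hp hpm (fun x hx => (hpU x hx).1) hGp
  obtain ⟨CΨ, hCΨ⟩ := exists_deriv_smoothTransition_le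
  set Ψ := Real.smoothTransition
  have hΨs : ContDiff ℝ ∞ Ψ := Real.smoothTransition.contDiff
  have hΨd : Differentiable ℝ Ψ := hΨs.differentiable (by simp)
  have hΨ'c : Continuous (deriv Ψ) := hΨs.continuous_deriv (by simp)
  have hΨ'0 : ∀ t, 0 ≤ deriv Ψ t := fun t => Real.smoothTransition.monotone.deriv_nonneg
  have hχd : Differentiable ℝ χ := hχ.smooth.differentiable (by simp)
  have hVd : Differentiable ℝ V := hV.differentiable (by simp)
  have hvd : ∀ j, Differentiable ℝ (v j) := fun j => (hv j).differentiable (by simp)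
  have hVc := continuous_gradient hV
  have hpS : ∀ x ∈ S, 1 ≤ p x := fun x hx => by linarith [(hpU x (hSU hx)).1]
  set θ : ℕ → E n → ℝ := fun j x => χ x * deriv Ψ (v j x - V x - d) with hθ
  set θ₀ : E n → ℝ := fun x => χ x * deriv Ψ (u x - V x - d) with hθ₀
  -- A smooth substitute for the positive part of `u - V - d`. The cutoff is 1 near the contact set
  -- `{V + c ≤ u}`.
  set φ : ℕ → E n → ℝ := fun j x => χ x * Ψ (v j x - V x - d) with hφ
  have hθc : ∀ j, Continuous (θ j) := fun j => hχ.smooth.continuous.mul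
    (hΨ'c.comp (((hv j).continuous.sub hV.continuous).sub continuous_const))
  have hθle : ∀ j x, |θ j x| ≤ CΨ := fun j x => by
    rw [hθ, abs_mul, abs_of_nonneg (hχ01 x).1]
    exact (mul_le_of_le_one_left (abs_nonneg _) (hχ01 x).2).trans (hCΨ _)
  have hvux : ∀ x ∈ S, Tendsto (fun j => v j x) atTop (𝓝 (u x)) := fun x hx =>
    hvu.tendsto_at hx
  have hθlim : ∀ x ∈ S, Tendsto (fun j => θ j x) atTop (𝓝 (θ₀ x)) := fun x hx =>
    ((hΨ'c.tendsto _).comp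
      (((hvux x hx).sub tendsto_const_nhds).sub tendsto_const_nhds)).const_mul _
  have hφs : ∀ j, ContDiff ℝ ∞ (φ j) := fun j => hχ.smooth.mul
    (hΨs.comp (((hv j).sub hV).sub contDiff_const))
  have hφS : ∀ j, tsupport (φ j) ⊆ S := fun j => tsupport_mul_subset_left
  have hφt : ∀ j, IsTestFunction U (φ j) := fun j =>
    ⟨hφs j, hχ.compact.mul_right, (hφS j).trans hSU⟩
  have hφ0 : ∀ j x, 0 ≤ φ j x := fun j x =>
    mul_nonneg (hχ01 x).1 (Real.smoothTransition.nonneg _)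
  have hφg : ∀ᶠ j in atTop, ∀ x,
      gradient (φ j) x = θ j x • (gradient (v j) x - gradient V x) := by
    -- Once `|v j - u| < d - c` on `S`, positivity of `v j - V - d` forces `u > V + c`, where the
    -- cutoff is locally constant.
    filter_upwards [Metric.tendstoUniformlyOn_iff.1 hvu (d - c) (by linarith)] with j hj x
    refine gradient_mul_comp_sub (hχd x) (hvd j x) (hVd x) hΨd ?_
    by_cases hx : x ∈ S
    · rcases le_or_gt (v j x - V x - d) 0 with h | h
      · exact Or.inl (Real.smoothTransition.zero_of_nonpos h)
      · right
        have h1 := hj x hx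
        rw [Real.dist_eq] at h1
        have h2 : x ∈ {x ∈ U | V x + c ≤ u x} :=
          ⟨hSU hx, by linarith [(abs_lt.1 h1).1]⟩
        rw [(hχ1 x h2).fderiv_eq]
        simp
    · right
      exact image_eq_zero_of_notMem_tsupport fun h => hx (tsupport_fderiv_subset ℝ h)
  obtain ⟨B, hB⟩ : ∃ B, ∀ x ∈ S, ‖gradient V x‖ ^ p x ≤ B := by
    have hcont : ContinuousOn (fun x => ‖gradient V x‖ ^ p x) S :=
      hVc.norm.continuousOn.rpow (hpc.mono hSU) fun x hx => Or.inr (by linarith [hpS x hx])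
    obtain ⟨B, hB⟩ := hS.exists_bound_of_continuousOn hcont
    exact ⟨B, fun x hx => (le_abs_self _).trans (hB x hx)⟩
  have hpm' : AEMeasurable p (volume.restrict S) := (hpc.mono hSU).aemeasurable hSm
  have hGm : AEStronglyMeasurable G (volume.restrict S) :=
    hG.locIntGrad.aestronglyMeasurable.mono_measure (Measure.restrict_mono hSU le_rfl)
  have main : ∀ X : E n → E n, AEStronglyMeasurable X (volume.restrict S) →
      IntegrableOn (fun x => ‖X x‖ ^ p x) S →
      IntegrableOn (fun x => θ₀ x * inner ℝ (‖X x‖ ^ (p x - 2) • X x) (G x - gradient V x)) S ∧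
      Tendsto (fun j => ∫ x in U, ‖X x‖ ^ (p x - 2) * inner ℝ (X x) (gradient (φ j) x)) atTop
      (𝓝 (∫ x in S, θ₀ x * inner ℝ (‖X x‖ ^ (p x - 2) • X x) (G x - gradient V x))) := by
    intro X hX hXp
    have hYm : AEStronglyMeasurable (fun x => ‖X x‖ ^ (p x - 2) • X x) (volume.restrict S) :=
      (hX.norm.aemeasurable.pow (hpm'.sub_const 2)).aestronglyMeasurable.smul hX
    obtain ⟨h1, h2⟩ := tendsto_integral_inner (p := p) hS (fun j => continuous_gradient (hv j)) hVc
      hvG hgi hg₀ hg0 hglim hgint hC hgle hB hθc hθle hθlim hYm one_pos.le hXp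
      (fun x hx s hs => by
        rw [one_mul]; exact norm_rpow_smul_mul_le _ hs (hpS x hx))
    refine ⟨h1, h2.congr' ?_⟩
    filter_upwards [hφg] with j hj
    rw [← setIntegral_eq_of_subset_of_forall_sdiff_eq_zero hU.measurableSet hSU]
    · refine integral_congr_ae (Eventually.of_forall fun x => ?_)
      simp only [hj x, real_inner_smul_left, real_inner_smul_right]
      ring
    · intro x hx
      simp [hθ, hχS x hx.2]
  obtain ⟨hGi, hGlim⟩ := main G hGm (hGp S hS hSU)
  obtain ⟨hVi, hVlim⟩ := main (gradient V) hVc.aestronglyMeasurable (by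
    refine (integrableOn_const (C := B) hS.measure_lt_top.ne).mono'
      ((hVc.norm.aemeasurable.pow hpm').aestronglyMeasurable) ?_
    filter_upwards [ae_restrict_mem hSm] with x hx
    rw [Real.norm_of_nonneg (by positivity)]
    exact hB x hx)
  have hG0 : ∫ x in S, θ₀ x * inner ℝ (‖G x‖ ^ (p x - 2) • G x) (G x - gradient V x) = 0 := by
    refine tendsto_nhds_unique hGlim ?_
    simp only [fun j => hsol (φ j) (hφt j)]
    exact tendsto_const_nhds
  have hV0 := ge_of_tendsto' hVlim fun j => hsuper (φ j) (hφt j) (hφ0 j)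
  have hθ₀0 : ∀ x, 0 ≤ θ₀ x := fun x => mul_nonneg (hχ01 x).1 (hΨ'0 _)
  have hmono : ∀ x ∈ S, 0 ≤ θ₀ x * inner ℝ (‖G x‖ ^ (p x - 2) • G x) (G x - gradient V x) -
      θ₀ x * inner ℝ (‖gradient V x‖ ^ (p x - 2) • gradient V x) (G x - gradient V x) := by
    intro x hx
    rw [← mul_sub, real_inner_smul_left, real_inner_smul_left]
    exact mul_nonneg (hθ₀0 x)
      (inner_rpow_smul_sub_nonneg (by linarith [(hpU x (hSU hx)).1]) _ _).1
  -- The limit is 0 for the solution and nonnegative for the barrier, so their monotone difference,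
  -- being nonnegative, vanishes a.e.; strictness gives `G = ∇V` where `θ₀ ≠ 0`.
  have hzero : ∀ᵐ x ∂(volume.restrict S), θ₀ x • (G x - gradient V x) = 0 := by
    have h1 : ∫ x in S, (θ₀ x * inner ℝ (‖G x‖ ^ (p x - 2) • G x) (G x - gradient V x) -
        θ₀ x * inner ℝ (‖gradient V x‖ ^ (p x - 2) • gradient V x) (G x - gradient V x)) = 0 := by
      refine le_antisymm ?_ (setIntegral_nonneg hSm hmono)
      rw [integral_sub hGi hVi, hG0]
      linarith
    rw [setIntegral_eq_zero_iff_of_nonneg_ae ((ae_restrict_iff' hSm).2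
      (Eventually.of_forall hmono)) (hGi.sub hVi)] at h1
    filter_upwards [h1, ae_restrict_mem hSm] with x hx hxS
    simp only [Pi.zero_apply] at hx
    rw [← mul_sub, real_inner_smul_left, real_inner_smul_left] at hx
    rcases mul_eq_zero.1 hx with h | h
    · rw [h, zero_smul]
    · rw [(inner_rpow_smul_sub_nonneg (by linarith [(hpU x (hSU hxS)).1]) _ _).2 h, sub_self,
        smul_zero]
  -- In place of a Poincaré inequality, `∫ φ j` is written through `∇φ j` paired with a field
  -- bounded on `S`, and therefore tends to 0.
  set e : E n := EuclideanSpace.single ⟨0, hn⟩ 1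
  have he : ‖e‖ = 1 := by simp [e]
  obtain ⟨R, hR⟩ := hS.isBounded.exists_norm_le
  have hlin := (tendsto_integral_inner (p := p) (Y := fun x => inner ℝ e x • e)
    (h := fun _ => |R|) (c := |R|) hS
    (fun j => continuous_gradient (hv j)) hVc hvG hgi hg₀ hg0 hglim hgint hC hgle hB hθc hθle hθlim
    (by fun_prop : Continuous fun x => inner ℝ e x • e).aestronglyMeasurable
    (abs_nonneg R) (integrableOn_const hS.measure_lt_top.ne) (fun x hx s hs => by
      have h1 : ‖inner ℝ e x • e‖ ≤ |R| := by
        rw [norm_smul, he, mul_one]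
        refine (norm_inner_le_norm _ _).trans ?_
        rw [he, one_mul]
        exact (hR x hx).trans (le_abs_self _)
      have h2 : s ≤ 1 + s ^ p x := by
        have := rpow_sub_one_mul_le zero_le_one hs (hpS x hx)
        simpa using this
      calc ‖inner ℝ e x • e‖ * s ≤ |R| * (1 + s ^ p x) := by gcongr
        _ = _ := by ring)).2
  have hlin0 : ∫ x in S, θ₀ x * inner ℝ (inner ℝ e x • e) (G x - gradient V x) = 0 := by
    refine integral_eq_zero_of_ae ?_
    filter_upwards [hzero] with x hx
    rw [← real_inner_smul_right, hx]
    simp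
  rw [hlin0] at hlin
  have hφint : Tendsto (fun j => ∫ x, φ j x) atTop (𝓝 0) := by
    have := hlin.neg
    rw [neg_zero] at this
    refine this.congr' ?_
    filter_upwards [hφg] with j hj
    rw [integral_eq_neg_integral_inner_gradient (hφs j) (hφt j).compact he]
    simp only [hj, real_inner_smul_right]
    congr 1
    refine setIntegral_eq_integral_of_forall_compl_eq_zero fun x hx => ?_
    simp [hθ, hχS x hx]
  set φ₀ : E n → ℝ := fun x => χ x * Ψ (u x - V x - d) with hφ₀
  have hφ₀c : ContinuousOn φ₀ U := hχ.smooth.continuous.continuousOn.mul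
    (hΨs.continuous.comp_continuousOn
      ((hu.sub hV.continuous.continuousOn).sub continuousOn_const))
  have hφ₀0 : ∀ x, 0 ≤ φ₀ x := fun x => mul_nonneg (hχ01 x).1 (Real.smoothTransition.nonneg _)
  have hφ₀S : ∀ x, x ∉ S → φ₀ x = 0 := fun x hx => by simp [hφ₀, hχS x hx]
  have hφ₀int : ∫ x in U, φ₀ x = 0 := by
    refine tendsto_nhds_unique ?_ hφint
    have : Tendsto (fun j => ∫ x in S, φ j x) atTop (𝓝 (∫ x in S, φ₀ x)) := by
      refine tendsto_integral_of_dominated_convergence (fun _ => 1)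
        (fun j => (hφs j).continuous.aestronglyMeasurable)
        (integrableOn_const hS.measure_lt_top.ne) (fun j => ?_) ?_
      · filter_upwards with x
        rw [Real.norm_of_nonneg (hφ0 j x)]
        exact mul_le_one₀ (hχ01 x).2 (Real.smoothTransition.nonneg _)
          (Real.smoothTransition.le_one _)
      · filter_upwards [ae_restrict_mem hSm] with x hx
        exact ((hΨs.continuous.tendsto _).comp
          (((hvux x hx).sub tendsto_const_nhds).sub tendsto_const_nhds)).const_mul _
    rw [setIntegral_eq_of_subset_of_forall_sdiff_eq_zero hU.measurableSet hSU
      fun x hx => hφ₀S x hx.2]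
    refine this.congr fun j => ?_
    refine setIntegral_eq_integral_of_forall_compl_eq_zero fun x hx => ?_
    simp [hφ, hχS x hx]
  have hφ₀i : IntegrableOn φ₀ U := by
    refine IntegrableOn.of_forall_sdiff_eq_zero (s := S) ?_ hU.measurableSet
      fun x hx => hφ₀S x hx.2
    exact (hφ₀c.mono hSU).integrableOn_compact hS
  -- A nonnegative function, continuous on the open set `U` and of zero integral there, vanishes
  -- throughout `U`.
  rw [integral_eq_zero_iff_of_nonneg hφ₀0 hφ₀i] at hφ₀int
  have hEq := Measure.eqOn_open_of_ae_eq hφ₀int hU hφ₀c continuousOn_const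
  intro x hx
  by_contra! hlt
  have h1 : χ x = 1 := (hχ1 x ⟨hx, by linarith⟩).self_of_nhds
  have h2 : φ₀ x = 0 := hEq hx
  simp only [hφ₀, h1, one_mul] at h2
  have := Real.smoothTransition.pos_of_pos (x := u x - V x - d) (by linarith)
  exact this.ne' h2

/-! ### Radial integration by parts -/

/-- Integration by parts along the radial field `x - η`. -/
lemma integral_mul_radial_eq {n : ℕ} {f ψ : E n → ℝ} {Kf : NNReal} (hf : LipschitzWith Kf f)
    (hψ : ContDiff ℝ ∞ ψ) (hc : HasCompactSupport ψ) (η : E n) :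
    Integrable (fun x => fderiv ℝ f x (x - η) * ψ x) ∧
    ∫ x, f x * (fderiv ℝ ψ x (x - η) + n * ψ x) = -∫ x, fderiv ℝ f x (x - η) * ψ x := by
  set e : Fin n → E n := fun i => EuclideanSpace.single i 1 with he
  have hψd : Differentiable ℝ ψ := hψ.differentiable (by simp)
  have hexp : ∀ z : E n, z = ∑ i, z i • e i := by
    intro z
    have := (EuclideanSpace.basisFun (Fin n) ℝ).sum_repr z
    simpa [he] using this.symm
  set g : Fin n → E n → ℝ := fun i x => ψ x * (x i - η i) with hg
  have hcoord : ∀ i, ContDiff ℝ ∞ fun x : E n => x i - η i := fun i => by fun_prop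
  have hgs : ∀ i, ContDiff ℝ ∞ (g i) := fun i => hψ.mul (hcoord i)
  have hgc : ∀ i, HasCompactSupport (g i) := fun i => hc.mul_right
  have hline : ∀ i x, lineDeriv ℝ (g i) x (-(e i)) =
      -(fderiv ℝ ψ x (e i) * (x i - η i) + ψ x) := by
    intro i x
    have hd : HasFDerivAt (fun x : E n => x i - η i)
        (EuclideanSpace.proj i : E n →L[ℝ] ℝ) x :=
      (EuclideanSpace.proj i : E n →L[ℝ] ℝ).hasFDerivAt.sub_const (η i)
    have h := ((hψd x).hasFDerivAt.mul hd).hasLineDerivAt (-(e i))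
    have h' : lineDeriv ℝ (g i) x (-(e i)) = _ := h.lineDeriv
    rw [h']
    simp [he]
    ring
  have hint : ∀ i, ∫ x, lineDeriv ℝ f x (e i) * g i x =
      ∫ x, -(fderiv ℝ ψ x (e i) * (x i - η i) + ψ x) * f x := by
    intro i
    obtain ⟨C, hC⟩ := (hgs i).lipschitzWith_of_hasCompactSupport (hgc i) (by simp)
    rw [hf.integral_lineDeriv_mul_eq hC (hgc i) (e i)]
    simp_rw [hline]
  have hi1 : ∀ i, Integrable fun x => lineDeriv ℝ f x (e i) * g i x := by
    intro i
    refine ((hgs i).continuous.integrable_of_hasCompactSupport (hgc i)).bdd_mul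
      (c := Kf * ‖e i‖) (aestronglyMeasurable_lineDeriv hf.continuous _) ?_
    filter_upwards with x
    exact norm_lineDeriv_le_of_lipschitz ℝ hf
  have hcont : ∀ i, Continuous fun x => -(fderiv ℝ ψ x (e i) * (x i - η i) + ψ x) * f x := by
    intro i
    exact (((((hψ.continuous_fderiv (by simp)).clm_apply continuous_const).mul
      (hcoord i).continuous).add hψ.continuous).neg).mul hf.continuous
  have hi2 : ∀ i, Integrable fun x => -(fderiv ℝ ψ x (e i) * (x i - η i) + ψ x) * f x := by
    intro i
    refine (hcont i).integrable_of_hasCompactSupport ?_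
    have h1 : HasCompactSupport fun x => fderiv ℝ ψ x (e i) * (x i - η i) :=
      (hc.fderiv_apply ℝ (e i)).mul_right
    exact (h1.add hc).neg.mul_right
  -- By Rademacher, the directional derivatives of `f` assemble into `fderiv ℝ f` almost everywhere.
  have hae : (fun x => ∑ i, lineDeriv ℝ f x (e i) * g i x) =ᵐ[volume]
      fun x => fderiv ℝ f x (x - η) * ψ x := by
    filter_upwards [hf.ae_differentiableAt] with x hx
    conv_rhs => rw [hexp (x - η)]
    rw [map_sum, Finset.sum_mul]
    refine Finset.sum_congr rfl fun i _ => ?_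
    rw [hx.lineDeriv_eq_fderiv]
    simp [hg]
    ring
  refine ⟨(integrable_finsetSum _ fun i _ => hi1 i).congr hae, ?_⟩
  rw [← integral_congr_ae hae, integral_finsetSum _ fun i _ => hi1 i]
  simp_rw [hint]
  rw [← integral_finsetSum _ fun i _ => hi2 i, ← integral_neg]
  refine integral_congr_ae (Eventually.of_forall fun x => ?_)
  have h1 : fderiv ℝ ψ x (x - η) = ∑ i, fderiv ℝ ψ x (e i) * (x i - η i) := by
    conv_lhs => rw [hexp (x - η)]
    rw [map_sum]
    refine Finset.sum_congr rfl fun i _ => ?_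
    simp
    ring
  simp only [h1]
  rw [← Finset.sum_mul, Finset.sum_neg_distrib, Finset.sum_add_distrib]
  simp
  ring

/-! ### The barrier and its supersolution property -/

/-- The radial barrier `B (1 - exp (-K (‖x - η‖² / a² - 1)))`. -/
noncomputable def barrier {n : ℕ} (η : E n) (a B K : ℝ) (x : E n) : ℝ :=
  B * (1 - Real.exp (-(K * (‖x - η‖ ^ 2 / a ^ 2 - 1))))

/-- The radial coefficient of the gradient of `barrier`. -/
noncomputable def barrierSlope {n : ℕ} (η : E n) (a B K : ℝ) (x : E n) : ℝ :=
  2 * B * K / a ^ 2 * Real.exp (-(K * (‖x - η‖ ^ 2 / a ^ 2 - 1)))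

section Barrier

variable {n : ℕ} (η : E n) (a B K : ℝ)

lemma hasFDerivAt_norm_sub_sq (x : E n) :
    HasFDerivAt (fun y : E n => ‖y - η‖ ^ 2) (2 • innerSL ℝ (x - η)) x := by
  have := ((hasFDerivAt_id x).sub_const η).norm_sq
  exact this.congr_fderiv (by ext; simp)

lemma contDiff_barrier : ContDiff ℝ ∞ (barrier η a B K) := by
  unfold barrier
  have h : ContDiff ℝ ∞ fun y : E n => ‖y - η‖ ^ 2 := (contDiff_id.sub contDiff_const).norm_sq ℝ
  exact contDiff_const.mul (contDiff_const.sub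
    (Real.contDiff_exp.comp (contDiff_const.mul ((h.div_const _).sub contDiff_const)).neg))

lemma contDiff_barrierSlope : ContDiff ℝ ∞ (barrierSlope η a B K) := by
  unfold barrierSlope
  have h : ContDiff ℝ ∞ fun y : E n => ‖y - η‖ ^ 2 := (contDiff_id.sub contDiff_const).norm_sq ℝ
  exact contDiff_const.mul
    (Real.contDiff_exp.comp (contDiff_const.mul ((h.div_const _).sub contDiff_const)).neg)

lemma hasFDerivAt_exponent (x : E n) :
    HasFDerivAt (fun y : E n => -(K * (‖y - η‖ ^ 2 / a ^ 2 - 1)))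
      ((-(2 * K / a ^ 2)) • innerSL ℝ (x - η)) x := by
  have := ((((hasFDerivAt_norm_sub_sq η x).mul_const (a ^ 2)⁻¹).sub_const 1).const_mul K).neg
  simp only [← div_eq_mul_inv] at this
  refine this.congr_fderiv ?_
  ext y
  simp
  ring

lemma gradient_barrier (x : E n) :
    gradient (barrier η a B K) x = barrierSlope η a B K x • (x - η) := by
  refine ext_inner_right ℝ fun y => ?_
  have h := (((hasFDerivAt_exponent η a K x).exp).const_sub 1).const_mul B
  have h' : fderiv ℝ (barrier η a B K) x = _ := h.fderiv
  rw [inner_gradient_left, h', barrierSlope]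
  simp [inner_smul_left, inner_sub_left]
  ring

lemma fderiv_barrierSlope (x y : E n) :
    fderiv ℝ (barrierSlope η a B K) x y =
      -(2 * K / a ^ 2) * barrierSlope η a B K x * inner ℝ (x - η) y := by
  have h := ((hasFDerivAt_exponent η a K x).exp).const_mul (2 * B * K / a ^ 2)
  have h' : fderiv ℝ (barrierSlope η a B K) x = _ := h.fderiv
  rw [h', barrierSlope]
  simp [inner_sub_left]
  ring

end Barrier

/-- The logarithm of the norm of the gradient of `barrier`. -/
noncomputable def logSlope {n : ℕ} (η : E n) (a B K : ℝ) (x : E n) : ℝ :=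
  Real.log (2 * B * K / a ^ 2) + -(K * (‖x - η‖ ^ 2 / a ^ 2 - 1)) + Real.log (‖x - η‖ ^ 2) / 2

section

variable {n : ℕ} {η : E n} {a B K : ℝ}

/-- In exponential form, the variable power `‖∇V‖ ^ (p - 2)` becomes `exp (logSlope * (p - 2))`,
which is differentiated by the product rule. -/
lemma norm_gradient_barrier (ha : 0 < a) (hB : 0 < B) (hK : 0 < K) {x : E n} (hx : x ≠ η) :
    ‖gradient (barrier η a B K) x‖ = Real.exp (logSlope η a B K x) := by
  have h0 : 0 < ‖x - η‖ := norm_pos_iff.2 (sub_ne_zero.2 hx)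
  have h1 : 0 < 2 * B * K / a ^ 2 := by positivity
  rw [gradient_barrier, norm_smul, Real.norm_of_nonneg (by unfold barrierSlope; positivity),
    logSlope, Real.log_pow, Real.exp_add, Real.exp_add, Real.exp_log h1, barrierSlope]
  congr 1
  rw [show ((2 : ℕ) : ℝ) * Real.log ‖x - η‖ / 2 = Real.log ‖x - η‖ by push_cast; ring,
    Real.exp_log h0]

lemma hasFDerivAt_logSlope {x : E n} (hx : x ≠ η) :
    HasFDerivAt (logSlope η a B K)
      ((-(2 * K / a ^ 2) + (‖x - η‖ ^ 2)⁻¹) • innerSL ℝ (x - η)) x := by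
  have h0 : ‖x - η‖ ^ 2 ≠ 0 := pow_ne_zero 2 (norm_ne_zero_iff.2 (sub_ne_zero.2 hx))
  have h1 := (hasFDerivAt_exponent η a K x).const_add (Real.log (2 * B * K / a ^ 2))
  have h2 := ((hasFDerivAt_norm_sub_sq η x).log h0).mul_const (2⁻¹ : ℝ)
  refine (h1.add h2).congr_fderiv ?_
  ext y
  simp
  ring

lemma contDiffAt_logSlope {x : E n} (hx : x ≠ η) : ContDiffAt ℝ ∞ (logSlope η a B K) x := by
  have h0 : ‖x - η‖ ^ 2 ≠ 0 := pow_ne_zero 2 (norm_ne_zero_iff.2 (sub_ne_zero.2 hx))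
  have h : ContDiffAt ℝ ∞ (fun y : E n => ‖y - η‖ ^ 2) x :=
    ((contDiff_id.sub contDiff_const).norm_sq ℝ).contDiffAt
  unfold logSlope
  exact (contDiffAt_const.add
    (contDiffAt_const.mul ((h.div_const _).sub contDiffAt_const)).neg).add ((h.log h0).div_const _)

/-- The weight `‖∇(barrier)‖ ^ (p - 2)` agrees with a globally Lipschitz function near a compact
set. -/
lemma exists_lipschitz_weight {U S : Set (E n)} {P : E n → ℝ} {KP : NNReal} {b : ℝ}
    (hU : IsOpen U) (hS : IsCompact S) (hSU : S ⊆ U) (hη : η ∉ U) (hP : LipschitzWith KP P)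
    (hPb : ∀ x ∈ U, |P x| ≤ b) :
    ∃ (f : E n → ℝ) (Kf : NNReal), LipschitzWith Kf f ∧
      ∀ x ∈ S, f =ᶠ[𝓝 x] fun y => Real.exp (logSlope η a B K y * (P y - 2)) := by
  obtain ⟨χ, hχ, -, hχ1⟩ := exists_cutoff hS hU hSU
  let β : ContDiffBump (0 : ℝ) := ⟨|b| + 1, |b| + 2, by positivity, by linarith⟩
  -- Treating the exponent as an independent variable makes `Φ` of class `C¹` with compact support,
  -- hence Lipschitz; then substitute `t = P y`.
  set Φ : ℝ × E n → ℝ := fun z =>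
    β z.1 * (χ z.2 * Real.exp (logSlope η a B K z.2 * (z.1 - 2))) with hΦ
  have hΦc : HasCompactSupport Φ := by
    refine HasCompactSupport.of_support_subset_isCompact
      ((isCompact_closedBall (0 : ℝ) β.rOut).prod hχ.compact) fun z hz => ?_
    rw [Function.mem_support] at hz
    refine ⟨?_, ?_⟩
    · have h1 : z.1 ∈ Function.support β := left_ne_zero_of_mul hz
      rw [β.support_eq] at h1
      exact ball_subset_closedBall h1
    · exact subset_tsupport _ (left_ne_zero_of_mul (right_ne_zero_of_mul hz))
  have hΦs : ContDiff ℝ 1 Φ := by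
    rw [contDiff_iff_contDiffAt]
    rintro ⟨t, y⟩
    have hβ : ContDiffAt ℝ 1 (fun z : ℝ × E n => β z.1) (t, y) :=
      (β.contDiff.comp contDiff_fst).contDiffAt
    by_cases hy : y ∈ tsupport χ
    · have hyη : y ≠ η := fun h => hη (h ▸ hχ.support hy)
      have h1 : ContDiffAt ℝ 1 (fun z : ℝ × E n => χ z.2) (t, y) :=
        ((hχ.smooth.comp contDiff_snd).of_le (by simp)).contDiffAt
      have h2 : ContDiffAt ℝ 1 (fun z : ℝ × E n => logSlope η a B K z.2) (t, y) :=
        ContDiffAt.comp (t, y) (g := logSlope η a B K) (f := Prod.snd)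
          ((contDiffAt_logSlope hyη).of_le (by simp)) contDiffAt_snd
      exact hβ.mul (h1.mul (h2.mul (contDiffAt_fst.sub contDiffAt_const)).exp)
    · have h0 : Φ =ᶠ[𝓝 (t, y)] fun _ => 0 := by
        have : ∀ᶠ z in 𝓝 y, χ z = 0 := notMem_tsupport_iff_eventuallyEq.1 hy
        filter_upwards [(continuous_snd.tendsto (t, y)).eventually this] with z hz
        simp [hΦ, hz]
      exact contDiffAt_const.congr_of_eventuallyEq h0
  obtain ⟨C, hC⟩ := hΦs.lipschitzWith_of_hasCompactSupport hΦc (by simp)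
  refine ⟨fun y => Φ (P y, y), _, hC.comp (hP.prodMk LipschitzWith.id), fun x hx => ?_⟩
  filter_upwards [hχ1 x hx, hU.mem_nhds (hSU hx)] with y hy hyU
  have h1 : β (P y) = 1 := by
    refine β.one_of_mem_closedBall ?_
    rw [mem_closedBall, Real.dist_eq, sub_zero]
    exact ((hPb y hyU).trans (le_abs_self b)).trans (by simp [β])
  simp [hΦ, hy, h1]

/-- The barrier is a weak supersolution when the radial inequality `hineq` holds. -/
lemma barrier_supersolution {U : Set (E n)} {p : E n → ℝ} {Kp : NNReal} {pm b L : ℝ}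
    (ha : 0 < a) (hB : 0 < B) (hK : 0 < K) (hU : IsOpen U) (hη : η ∉ U)
    (hp : LipschitzOnWith Kp p U) (hpm : 0 ≤ pm) (hpU : ∀ x ∈ U, pm ≤ p x ∧ p x ≤ b)
    (hL : ∀ᵐ x, x ∈ U → ‖gradient p x‖ ≤ L)
    (hineq : ∀ x ∈ U, L * ‖x - η‖ * |logSlope η a B K x| + (p x - 2) + n ≤
      2 * K / a ^ 2 * ‖x - η‖ ^ 2 * (p x - 1)) {φ : E n → ℝ} (hφ : IsTestFunction U φ)
    (hφ0 : ∀ x, 0 ≤ φ x) :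
    0 ≤ ∫ x in U, ‖gradient (barrier η a B K) x‖ ^ (p x - 2) *
      inner ℝ (gradient (barrier η a B K) x) (gradient φ x) := by
  obtain ⟨P, hP, hPp⟩ := hp.extend_real
  obtain ⟨f, Kf, hf, hfeq⟩ := exists_lipschitz_weight (a := a) (B := B) (K := K) (b := b) hU
    hφ.compact hφ.support hη hP (fun x hx => by
      rw [← hPp hx, abs_of_nonneg (hpm.trans (hpU x hx).1)]; exact (hpU x hx).2)
  set S := tsupport φ
  have hφS : ∀ x, x ∉ S → φ x = 0 := fun x hx => image_eq_zero_of_notMem_tsupport hx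
  have hfφS : ∀ x, x ∉ S → fderiv ℝ φ x = 0 := fun x hx =>
    image_eq_zero_of_notMem_tsupport fun h => hx (tsupport_fderiv_subset ℝ h)
  have hφd : Differentiable ℝ φ := hφ.smooth.differentiable (by simp)
  set σ := barrierSlope η a B K with hσ
  have hσs : ContDiff ℝ ∞ σ := contDiff_barrierSlope η a B K
  have hσd : Differentiable ℝ σ := hσs.differentiable (by simp)
  have hσ0 : ∀ x, 0 ≤ σ x := fun x => by rw [hσ, barrierSlope]; positivity
  -- The flux is `f σ (x - η)`. Putting `σ` into the test function leaves the Lipschitz weight `f`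
  -- to be integrated by parts.
  set ψ : E n → ℝ := fun x => φ x * σ x with hψ
  have hψs : ContDiff ℝ ∞ ψ := hφ.smooth.mul hσs
  have hψc : HasCompactSupport ψ := hφ.compact.mul_right
  obtain ⟨hfi, hibp⟩ := integral_mul_radial_eq hf hψs hψc η
  have hψ' : ∀ x, fderiv ℝ ψ x (x - η) =
      σ x * fderiv ℝ φ x (x - η) - 2 * K / a ^ 2 * ‖x - η‖ ^ 2 * ψ x := by
    intro x
    have h : fderiv ℝ ψ x = _ := ((hφd x).hasFDerivAt.mul (hσd x).hasFDerivAt).fderiv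
    rw [h]
    simp only [add_apply, smul_apply, smul_eq_mul, hψ]
    rw [hσ, fderiv_barrierSlope, real_inner_self_eq_norm_sq]
    ring
  set q : E n → ℝ := fun x => (2 * K / a ^ 2 * ‖x - η‖ ^ 2 - n) * (f x * ψ x) with hq
  have hqi : Integrable q := by
    refine Continuous.integrable_of_hasCompactSupport ?_ hψc.mul_left.mul_left
    have := hf.continuous
    have := hψs.continuous
    fun_prop
  have hri : Integrable fun x => f x * (fderiv ℝ ψ x (x - η) + n * ψ x) := by
    refine Continuous.integrable_of_hasCompactSupport ?_ ?_
    · exact hf.continuous.mul (((hψs.continuous_fderiv (by simp)).clm_apply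
        (continuous_id.sub continuous_const)).add (continuous_const.mul hψs.continuous))
    · refine HasCompactSupport.mul_left (HasCompactSupport.add ?_ hψc.mul_left)
      exact (hψc.fderiv ℝ).mono' fun x hx => subset_tsupport _ fun h => hx (by
        simp [h])
  have hrep : ∫ x in U, ‖gradient (barrier η a B K) x‖ ^ (p x - 2) *
      inner ℝ (gradient (barrier η a B K) x) (gradient φ x) =
      ∫ x, (f x * (fderiv ℝ ψ x (x - η) + n * ψ x) + q x) := by
    rw [setIntegral_eq_integral_of_forall_compl_eq_zero]
    · refine integral_congr_ae (Eventually.of_forall fun x => ?_)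
      simp only [hq, hψ']
      by_cases hx : x ∈ S
      · have hxη : x ≠ η := fun h => hη (h ▸ hφ.support hx)
        rw [(hfeq x hx).self_of_nhds, norm_gradient_barrier ha hB hK hxη, ← Real.exp_mul,
          hPp (hφ.support hx), gradient_barrier, real_inner_smul_left, real_inner_comm,
          inner_gradient_left]
        ring
      · simp [hψ, hφS x hx, hfφS x hx, gradient]
    · intro x hx
      have : x ∉ S := fun h => hx (hφ.support h)
      simp [gradient, hfφS x this]
  rw [hrep, integral_add hri hqi, hibp, neg_add_eq_sub, ← integral_sub hqi hfi]
  refine integral_nonneg_of_ae ?_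
  filter_upwards [hL, hP.ae_differentiableAt] with x hxL hxP
  simp only [Pi.zero_apply]
  by_cases hx : x ∈ S
  swap
  · simp [hq, hψ, hφS x hx]
  have hxU := hφ.support hx
  have hxη : x ≠ η := fun h => hη (h ▸ hxU)
  have hn0 : ‖x - η‖ ^ 2 ≠ 0 := pow_ne_zero 2 (norm_ne_zero_iff.2 (sub_ne_zero.2 hxη))
  have hpP : p =ᶠ[𝓝 x] P := by
    filter_upwards [hU.mem_nhds hxU] with y hy using hPp hy
  have hfd := (((hasFDerivAt_logSlope (a := a) (B := B) (K := K) hxη).mul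
    (hxP.hasFDerivAt.sub_const 2)).exp).congr_of_eventuallyEq (hfeq x hx)
  have hdp : |fderiv ℝ P x (x - η)| ≤ L * ‖x - η‖ := by
    rw [← hpP.fderiv_eq, ← inner_gradient_left]
    exact (abs_real_inner_le_norm _ _).trans
      (mul_le_mul_of_nonneg_right (hxL hxU) (norm_nonneg _))
  have hprod : logSlope η a B K x * fderiv ℝ P x (x - η) ≤
      L * ‖x - η‖ * |logSlope η a B K x| := by
    calc _ ≤ |logSlope η a B K x * fderiv ℝ P x (x - η)| := le_abs_self _
      _ = |fderiv ℝ P x (x - η)| * |logSlope η a B K x| := by rw [abs_mul, mul_comm]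
      _ ≤ _ := by gcongr
  have hfx : 0 < f x := by rw [(hfeq x hx).self_of_nhds]; positivity
  -- The left side is `-φ` times the divergence of the flux; the bracket is the quantity controlled
  -- by `hineq`.
  have hcalc : q x - fderiv ℝ f x (x - η) * ψ x =
      f x * ψ x * (2 * K / a ^ 2 * ‖x - η‖ ^ 2 * (p x - 1) - n - (p x - 2) -
        logSlope η a B K x * fderiv ℝ P x (x - η)) := by
    rw [hfd.fderiv, hPp hxU, hq]
    simp only [add_apply, smul_apply, smul_eq_mul,
      innerSL_apply_apply, real_inner_self_eq_norm_sq]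
    rw [show Real.exp ((logSlope η a B K * fun x => P x - 2) x) = f x from
      (hfeq x hx).self_of_nhds.symm]
    have h1 : (‖x - η‖ ^ 2)⁻¹ * ‖x - η‖ ^ 2 = 1 := inv_mul_cancel₀ hn0
    linear_combination (-(f x * ψ x * (P x - 2))) * h1
  rw [hcalc]
  refine mul_nonneg (mul_nonneg hfx.le (mul_nonneg (hφ0 x) (hσ0 x))) ?_
  linarith [hineq x hxU]

end

/-! ### Restriction to subsets and pointwise bounds on the exponent -/

lemma IsTestFunction.mono {n : ℕ} {U U' : Set (E n)} {φ : E n → ℝ} (h : U' ⊆ U)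
    (hφ : IsTestFunction U' φ) : IsTestFunction U φ :=
  ⟨hφ.smooth, hφ.compact, hφ.support.trans h⟩

lemma IsTestFunction.gradient_eq_zero {n : ℕ} {U : Set (E n)} {φ : E n → ℝ}
    (hφ : IsTestFunction U φ) {x : E n} (hx : x ∉ U) : gradient φ x = 0 := by
  have : fderiv ℝ φ x = 0 := image_eq_zero_of_notMem_tsupport fun h =>
    hx (hφ.support (tsupport_fderiv_subset ℝ h))
  simp [gradient, this]

/-- Being a weak solution is inherited by smaller sets. -/
lemma IsWeakSolution.mono {n : ℕ} {U U' : Set (E n)} {p u : E n → ℝ} (hU : MeasurableSet U)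
    (h : U' ⊆ U) (hu : IsWeakSolution p U u) : IsWeakSolution p U' u := by
  obtain ⟨G, ⟨hG, hmem⟩, hsol⟩ := hu
  refine ⟨G, ⟨⟨hG.locInt.mono_set h, hG.locIntGrad.mono_set h, fun φ hφ => ?_⟩,
    fun K hK hKU => hmem K hK (hKU.trans h)⟩, fun φ hφ => ?_⟩
  · rw [← setIntegral_eq_of_subset_of_forall_sdiff_eq_zero hU h,
      ← setIntegral_eq_of_subset_of_forall_sdiff_eq_zero hU h]
    · exact hG.byParts φ (hφ.mono h)
    · intro x hx
      rw [image_eq_zero_of_notMem_tsupport fun h' => hx.2 (hφ.support h'), zero_smul]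
    · intro x hx
      rw [hφ.gradient_eq_zero hx.2, smul_zero]
  · rw [← setIntegral_eq_of_subset_of_forall_sdiff_eq_zero hU h]
    · exact hsol φ (hφ.mono h)
    · intro x hx
      rw [hφ.gradient_eq_zero hx.2, inner_zero_right, mul_zero]

/-- By continuity the exceptional set is open, and a null open set is empty. -/
lemma forall_mem_of_ae_restrict {n : ℕ} {U : Set (E n)} {p : E n → ℝ} {t : Set ℝ}
    (hU : IsOpen U) (hp : ContinuousOn p U) (ht : IsClosed t)
    (h : ∀ᵐ x ∂(volume.restrict U), p x ∈ t) : ∀ x ∈ U, p x ∈ t := by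
  have ho : IsOpen (U ∩ p ⁻¹' tᶜ) := hp.isOpen_inter_preimage hU ht.isOpen_compl
  have h0 : volume (U ∩ p ⁻¹' tᶜ) = 0 := by
    rw [ae_restrict_iff' hU.measurableSet, ae_iff] at h
    convert h using 2
    ext x
    simp
  have he := ho.eq_empty_of_measure_zero h0
  intro x hx
  by_contra hxt
  exact (Set.eq_empty_iff_forall_notMem.1 he x) ⟨hx, hxt⟩

/-! ### Choice of parameters and size of the barrier -/

/-- This controls `log a` in the logarithm of the slope uniformly for small radii. -/
lemma mul_abs_log_le {a : ℝ} (ha : 0 < a) : a * |Real.log a| ≤ 1 + a ^ 2 := by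
  have h1 := Real.log_le_sub_one_of_pos ha
  have h2 := Real.one_sub_inv_le_log_of_pos ha
  have h3 : a * (1 - a⁻¹) = a - 1 := by field_simp
  have h4 := mul_le_mul_of_nonneg_left h1 ha.le
  have h5 := mul_le_mul_of_nonneg_left h2 ha.le
  rcases abs_cases (Real.log a) with ⟨h, -⟩ | ⟨h, -⟩ <;> rw [h] <;> nlinarith

/-- The radial inequality making the barrier a supersolution. -/
lemma radial_inequality {a re L q B K ρ t N : ℝ} (ha : 0 < a) (hare : a ≤ re) (hL : 0 ≤ L)
    (haL : 12 * a * L ≤ q) (hB : 0 < B) (hK : 1 ≤ K) (hq : 0 < q)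
    (hKT : 3 * (2 * re * L * (|Real.log (2 * B)| + 1) + 2 * L * (1 + re ^ 2) + N) ≤ q * K)
    (hρ : a ≤ ρ) (hρ2 : ρ ≤ 2 * a) (ht : q ≤ t - 1) :
    L * ρ * |Real.log (2 * B * K / a ^ 2) + -(K * (ρ ^ 2 / a ^ 2 - 1)) + Real.log (ρ ^ 2) / 2| +
      (t - 2) + N ≤ 2 * K / a ^ 2 * ρ ^ 2 * (t - 1) := by
  have hK0 : 0 < K := by linarith
  have hρ0 : 0 < ρ := by linarith
  set s := ρ ^ 2 / a ^ 2 with hs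
  have hs1 : 1 ≤ s := by rw [hs, one_le_div (by positivity)]; gcongr
  have hs4 : s ≤ 4 := by rw [hs, div_le_iff₀ (by positivity)]; nlinarith
  have hlog : Real.log (2 * B * K / a ^ 2) + Real.log (ρ ^ 2) / 2 =
      Real.log (2 * B) + Real.log K + Real.log (ρ / a) - Real.log a := by
    rw [Real.log_div (by positivity) (by positivity), Real.log_mul (by positivity) hK0.ne',
      Real.log_pow, Real.log_pow, Real.log_div hρ0.ne' ha.ne']
    push_cast
    ring
  have hlogK : 0 ≤ Real.log K := Real.log_nonneg hK
  have hlogK' : Real.log K ≤ K := (Real.log_le_sub_one_of_pos hK0).trans (by linarith)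
  have hr0 : 0 ≤ Real.log (ρ / a) := Real.log_nonneg ((one_le_div ha).2 hρ)
  have hr1 : Real.log (ρ / a) ≤ 1 := by
    have h1 : ρ / a ≤ 2 := (div_le_iff₀ ha).2 hρ2
    exact (Real.log_le_sub_one_of_pos (by positivity)).trans (by linarith)
  have hKs0 : 0 ≤ K * (s - 1) := mul_nonneg hK0.le (by linarith)
  have hKs : K * (s - 1) ≤ 3 * K := by nlinarith
  have habs : |Real.log (2 * B * K / a ^ 2) + -(K * (s - 1)) + Real.log (ρ ^ 2) / 2| ≤
      |Real.log (2 * B)| + 1 + |Real.log a| + 4 * K := by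
    rw [show Real.log (2 * B * K / a ^ 2) + -(K * (s - 1)) + Real.log (ρ ^ 2) / 2 =
      Real.log (2 * B) + Real.log K + Real.log (ρ / a) - Real.log a - K * (s - 1) by
      linarith [hlog], abs_le]
    constructor <;> linarith [neg_abs_le (Real.log (2 * B)), le_abs_self (Real.log (2 * B)),
      neg_abs_le (Real.log a), le_abs_self (Real.log a)]
  -- The part of the logarithm linear in `K` contributes `8 a L K`, at most two thirds of `q K` by
  -- `haL`; `hKT` fits the rest into the remaining third.
  have h1 : L * ρ * |Real.log (2 * B * K / a ^ 2) + -(K * (s - 1)) + Real.log (ρ ^ 2) / 2| ≤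
      2 * re * L * (|Real.log (2 * B)| + 1) + 2 * L * (1 + re ^ 2) + 2 / 3 * (q * K) := by
    calc _ ≤ L * (2 * a) * (|Real.log (2 * B)| + 1 + |Real.log a| + 4 * K) := by gcongr
      _ = 2 * a * L * (|Real.log (2 * B)| + 1) + 2 * L * (a * |Real.log a|) +
          2 / 3 * (12 * a * L * K) := by ring
      _ ≤ 2 * re * L * (|Real.log (2 * B)| + 1) + 2 * L * (1 + re ^ 2) + 2 / 3 * (q * K) := by
        have h2 : a * |Real.log a| ≤ 1 + re ^ 2 := (mul_abs_log_le ha).trans (by gcongr)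
        gcongr
  have h2 : 2 * K / a ^ 2 * ρ ^ 2 * (t - 1) = 2 * K * s * (t - 1) := by rw [hs]; ring
  have ht0 : 0 ≤ t - 1 := by linarith
  have h3 : 2 * K * (t - 1) ≤ 2 * K * s * (t - 1) := by
    have : 2 * K * 1 ≤ 2 * K * s := by gcongr
    nlinarith
  have h4 : q * K ≤ K * (t - 1) := by nlinarith
  have h5 : t - 1 ≤ K * (t - 1) := by nlinarith
  rw [h2]
  linarith

lemma barrier_nonneg {n : ℕ} {η : E n} {a B K : ℝ} (ha : 0 < a) (hB : 0 ≤ B) (hK : 0 ≤ K)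
    {x : E n} (hx : a ≤ ‖x - η‖) : 0 ≤ barrier η a B K x := by
  refine mul_nonneg hB (sub_nonneg.2 (Real.exp_le_one_iff.2 (neg_nonpos.2 (mul_nonneg hK ?_))))
  rw [sub_nonneg, one_le_div (by positivity)]
  gcongr

lemma half_le_barrier {n : ℕ} {η : E n} {a B K : ℝ} (ha : 0 < a) (hB : 0 ≤ B) (hK : 1 ≤ K)
    {x : E n} (hx : ‖x - η‖ = 2 * a) : B / 2 ≤ barrier η a B K x := by
  have h1 : K * (‖x - η‖ ^ 2 / a ^ 2 - 1) = 3 * K := by rw [hx]; field_simp; ring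
  have h2 : Real.exp (-(3 * K)) ≤ 1 / 2 := by
    rw [Real.exp_neg, one_div]
    refine inv_anti₀ two_pos ?_
    linarith [Real.add_one_le_exp (3 * K)]
  rw [barrier, h1]
  nlinarith

/-- Linear growth comes from `1 - exp (-t) ≤ t`. -/
lemma barrier_le {n : ℕ} {η : E n} {a B K d : ℝ} (ha : 0 < a) (hB : 0 ≤ B) (hK : 0 ≤ K)
    {x : E n} (hd : 0 ≤ d) (hda : d ≤ a) (hx2 : ‖x - η‖ ≤ a + d) :
    barrier η a B K x ≤ 3 * B * K * (d / a) := by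
  have h1 : ‖x - η‖ ^ 2 / a ^ 2 - 1 ≤ 3 * (d / a) := by
    have h2 : ‖x - η‖ ^ 2 ≤ (a + d) ^ 2 := by gcongr
    have h3 : (a + d) ^ 2 / a ^ 2 - 1 = (2 * a + d) * d / a ^ 2 := by field_simp; ring
    calc ‖x - η‖ ^ 2 / a ^ 2 - 1 ≤ (a + d) ^ 2 / a ^ 2 - 1 := by gcongr
      _ = (2 * a + d) * d / a ^ 2 := h3
      _ ≤ (3 * a) * d / a ^ 2 := by gcongr; linarith
      _ = 3 * (d / a) := by field_simp
  have h4 := Real.add_one_le_exp (-(K * (‖x - η‖ ^ 2 / a ^ 2 - 1)))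
  calc barrier η a B K x ≤ B * (K * (‖x - η‖ ^ 2 / a ^ 2 - 1)) := by
        rw [barrier]; gcongr; linarith
    _ ≤ B * (K * (3 * (d / a))) := by gcongr
    _ = _ := by ring

/-! ### Exterior balls and comparison with the barrier -/

/-- Tangent balls of smaller radius. -/
lemma ExteriorBallCondition.exists_ball {n : ℕ} {Ω : Set (E n)} {re a : ℝ}
    (h : ExteriorBallCondition Ω re) (ha : 0 < a) (har : a ≤ re) {ζ : E n}
    (hζ : ζ ∈ frontier Ω) : ∃ η, dist ζ η = a ∧ ∀ y ∈ Ω, a ≤ dist y η := by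
  obtain ⟨η₀, -, hball, hsph⟩ := h ζ hζ
  have hre : 0 < re := ha.trans_le har
  have h1 : dist ζ η₀ = re := by
    have : ζ ∈ sphere η₀ re ∩ frontier Ω := by rw [hsph]; rfl
    exact this.1
  -- Moving the centre from `ζ` towards `η₀` by `a` keeps the smaller ball inside the original one.
  refine ⟨AffineMap.lineMap ζ η₀ (a / re), ?_, fun y hy => ?_⟩
  · rw [dist_left_lineMap, h1, Real.norm_of_nonneg (by positivity)]
    field_simp
  · have h2 : re ≤ dist y η₀ := by
      by_contra! hlt
      exact hball hlt hy
    have h3 : dist (AffineMap.lineMap ζ η₀ (a / re) : E n) η₀ = re - a := by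
      rw [dist_lineMap_right, h1, Real.norm_of_nonneg (by
        rw [sub_nonneg, div_le_one hre]; exact har)]
      field_simp
    linarith [dist_triangle y (AffineMap.lineMap ζ η₀ (a / re)) η₀]

/-- Linear growth away from a boundary point with an exterior tangent ball of radius `a`. -/
lemma le_of_tangent_ball {n : ℕ} (hn : 0 < n) {Ω : Set (E n)} {p u : E n → ℝ} {w η x : E n}
    {Kp : NNReal} {re r a L pm b M B K d : ℝ} (hΩ : IsOpen Ω) (hp : LipschitzOnWith Kp p Ω)
    (hpm : 1 < pm) (hpΩ : ∀ x ∈ Ω, pm ≤ p x ∧ p x ≤ b)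
    (hgrad : ∀ᵐ x, x ∈ Ω → ‖gradient p x‖ ≤ L)
    (hu : IsWeakSolution p (Ω ∩ ball w r) u) (huc : ContinuousOn u (closure Ω ∩ ball w r))
    (hu0 : ∀ x ∈ frontier Ω ∩ ball w r, u x = 0)
    (ha : 0 < a) (hare : a ≤ re) (hL : 0 ≤ L) (haL : 12 * a * L ≤ pm - 1)
    (hMB : M < B / 2) (hB : 0 < B) (hK : 1 ≤ K)
    (hKT : 3 * (2 * re * L * (|Real.log (2 * B)| + 1) + 2 * L * (1 + re ^ 2) + n) ≤ (pm - 1) * K)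
    (hball : closedBall η (2 * a) ⊆ ball w r) (hM : ∀ y ∈ Ω ∩ closedBall η (2 * a), u y ≤ M)
    (hη : ∀ y ∈ Ω, a ≤ dist y η) (hx : x ∈ Ω) (hd : 0 ≤ d) (hda : d < a)
    (hxη : dist x η ≤ a + d) : u x ≤ 3 * B * K * (d / a) := by
  set U := Ω ∩ ball η (2 * a) with hU
  have hUo : IsOpen U := hΩ.inter isOpen_ball
  have hUsub : U ⊆ Ω ∩ ball w r :=
    Set.inter_subset_inter_right _ (ball_subset_closedBall.trans hball)
  have hK0 : 0 < K := by linarith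
  set V := barrier η a B K with hVdef
  have hVs : ContDiff ℝ ∞ V := contDiff_barrier η a B K
  have hηcl : ∀ y ∈ closure Ω, a ≤ dist y η := by
    intro y hy
    exact closure_minimal (t := {y | a ≤ dist y η}) hη
      (isClosed_le continuous_const (continuous_id.dist continuous_const)) hy
  have hηΩ : η ∉ Ω := fun h => by
    have := hη η h
    rw [dist_self] at this
    linarith
  have hsup : ∀ φ, IsTestFunction U φ → (∀ x, 0 ≤ φ x) → 0 ≤ ∫ x in U,
      ‖gradient V x‖ ^ (p x - 2) * inner ℝ (gradient V x) (gradient φ x) := by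
    intro φ hφ hφ0
    refine barrier_supersolution (L := L) (pm := pm) (b := b) ha hB hK0 hUo (fun h => hηΩ h.1)
      (hp.mono Set.inter_subset_left) (by linarith) (fun x hx => hpΩ x hx.1) ?_ ?_ hφ hφ0
    · filter_upwards [hgrad] with x hx hxU using hx hxU.1
    · intro y hy
      refine radial_inequality ha hare hL haL hB hK (by linarith) hKT ?_ ?_
        (by linarith [(hpΩ y hy.1).1])
      · rw [← dist_eq_norm]; exact hη y hy.1
      · rw [← dist_eq_norm]; exact (mem_ball.1 hy.2).le
  have hxU : x ∈ U := ⟨hx, by rw [mem_ball]; linarith⟩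
  have hcomp : ∀ ε : ℝ, 0 < ε → u x ≤ V x + 2 * ε := by
    intro ε hε
    refine IsWeakSolution.le_add_of_isCompact (c := ε) hn hUo (hp.mono Set.inter_subset_left) hpm
      (fun x hx => hpΩ x hx.1)
      (huc.mono (hUsub.trans (Set.inter_subset_inter_left _ subset_closure)))
      (hu.mono (hΩ.inter isOpen_ball).measurableSet hUsub) hVs hsup ?_ (by linarith) x hxU
    -- The contact set is closed in the compact `F`. It misses `∂Ω`, where `u = 0 ≤ V`, and the
    -- outer sphere, where `u ≤ M < B / 2 ≤ V`, so it lies in `U`.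
    set F := closure Ω ∩ closedBall η (2 * a)
    have hF : IsCompact F := (isCompact_closedBall _ _).inter_left isClosed_closure
    have hFc : ContinuousOn (fun y => u y - V y) F :=
      (huc.mono (Set.inter_subset_inter_right _ hball)).sub hVs.continuous.continuousOn
    have hc : IsCompact (F ∩ (fun y => u y - V y) ⁻¹' Set.Ici ε) :=
      hF.of_isClosed_subset (hFc.preimage_isClosed_of_isClosed hF.isClosed isClosed_Ici)
        Set.inter_subset_left
    convert hc using 1
    ext y
    constructor
    · rintro ⟨hy, hyε⟩
      exact ⟨⟨subset_closure hy.1, ball_subset_closedBall hy.2⟩,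
        by simp only [Set.mem_preimage, Set.mem_Ici]; linarith⟩
    · rintro ⟨⟨hy1, hy2⟩, hyε⟩
      simp only [Set.mem_preimage, Set.mem_Ici] at hyε
      have hyΩ : y ∈ Ω := by
        by_contra hyn
        have h1 : y ∈ frontier Ω := by rw [hΩ.frontier_eq]; exact ⟨hy1, hyn⟩
        have h2 := hu0 y ⟨h1, hball hy2⟩
        have h3 : 0 ≤ V y := barrier_nonneg ha hB.le hK0.le (by
          rw [← dist_eq_norm]; exact hηcl y hy1)
        linarith
      refine ⟨⟨hyΩ, mem_ball.2 (lt_of_le_of_ne hy2 fun h => ?_)⟩, by linarith⟩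
      have h1 : B / 2 ≤ V y := half_le_barrier ha hB.le hK (by rw [← dist_eq_norm]; exact h)
      linarith [hM y ⟨hyΩ, hy2⟩]
  have h1 : u x ≤ V x := by
    refine le_of_forall_pos_le_add fun ε hε => ?_
    have := hcomp (ε / 2) (half_pos hε)
    linarith
  exact h1.trans (barrier_le ha hB.le hK0.le hd hda.le (by rw [← dist_eq_norm]; exact hxη))

end VarExp

/-! ### Choice of constants and conclusion -/

/-- The order of quantifiers encodes the dependence of the constants. Boundedness is stated
separately because the real `sSup` of an unbounded set is 0. -/
theorem lemma5p3 :
    ∀ re pm L : ℝ, 0 < re → 1 < pm → 0 ≤ L →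
    ∃ ct : ℝ, 2 < ct ∧
    ∀ (n : ℕ) (pp M : ℝ), 2 ≤ n →
    ∃ c : ℝ, 0 < c ∧
    ∀ (Ω : Set (VarExp.E n)) (p : VarExp.E n → ℝ) (w : VarExp.E n) (r : ℝ)
      (u : VarExp.E n → ℝ),
      VarExp.IsDomainSet Ω →
      VarExp.ExteriorBallCondition Ω re →
      w ∈ frontier Ω → 0 < r → r < re →
      VarExp.IsBoundedLipschitzExponent Ω p →
      pm ≤ VarExp.pMinus Ω p → VarExp.pPlus Ω p ≤ pp →
      VarExp.gradNorm Ω p ≤ ENNReal.ofReal L →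
      VarExp.IsPHarmonic p (Ω ∩ ball w r) u →
      (∀ x ∈ Ω ∩ ball w r, 0 < u x) →
      ContinuousOn u (closure Ω ∩ ball w r) →
      (∀ x ∈ frontier Ω ∩ ball w r, u x = 0) →
      BddAbove (u '' (Ω ∩ ball w (2 * (r / ct)))) ∧
      (sSup (u '' (Ω ∩ ball w (2 * (r / ct)))) ≤ M →
        ∀ x ∈ Ω ∩ ball w (r / ct), u x ≤ c * (infDist x (frontier Ω) / r)) := by
  intro re pm L hre hpm hL
  have hq : 0 < pm - 1 := by linarith
  -- The 3 gives `2 r / ct < r`; the other summand gives `12 (r / ct) L ≤ pm - 1`.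
  set ct : ℝ := 3 + 12 * re * L / (pm - 1) with hct
  have hct3 : 3 ≤ ct := le_add_of_nonneg_right (by positivity)
  have hct0 : 0 < ct := by linarith
  refine ⟨ct, by linarith, fun n pp M hn => ?_⟩
  set B : ℝ := 2 * (|M| + 1) with hB
  have hB0 : 0 < B := by positivity
  set T : ℝ := 3 * (2 * re * L * (|Real.log (2 * B)| + 1) + 2 * L * (1 + re ^ 2) + n) with hT
  set K : ℝ := max 1 (T / (pm - 1)) with hK
  have hK1 : 1 ≤ K := le_max_left _ _
  have hK0 : 0 < K := by linarith
  have hKT : T ≤ (pm - 1) * K := by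
    rw [mul_comm, ← div_le_iff₀ hq]
    exact le_max_right _ _
  -- Here `48 = 3 * 16`: the barrier gives `3 B K d / a` with `a = r / (16 ct)`.
  refine ⟨48 * B * K * ct, by positivity, ?_⟩
  intro Ω p w r u hΩ hext hw hr hrre hp hpmin _ hgrad hu hupos huc hu0
  have hΩo := hΩ.isOpen
  have h2r : 2 * (r / ct) < r := by
    rw [← mul_div_assoc, div_lt_iff₀ hct0]
    nlinarith
  have hbdd : BddAbove (u '' (Ω ∩ ball w (2 * (r / ct)))) := by
    have hc : IsCompact (closure Ω ∩ closedBall w (2 * (r / ct))) :=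
      (isCompact_closedBall _ _).inter_left isClosed_closure
    refine (hc.image_of_continuousOn (huc.mono ?_)).bddAbove.mono ?_
    · exact Set.inter_subset_inter_right _ (closedBall_subset_ball h2r)
    · exact Set.image_mono (Set.inter_subset_inter subset_closure ball_subset_closedBall)
  refine ⟨hbdd, fun hM x hx => ?_⟩
  have huM : ∀ y ∈ Ω ∩ ball w (2 * (r / ct)), u y ≤ M := fun y hy =>
    (le_csSup hbdd ⟨y, hy, rfl⟩).trans hM
  set d := infDist x (frontier Ω) with hd
  have hd0 : 0 ≤ d := infDist_nonneg
  set R := r / ct with hR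
  have hR0 : 0 < R := div_pos hr hct0
  set a := R / 16 with ha
  have ha0 : 0 < a := by positivity
  have hfinal : 48 * B * K * ct * (d / r) = 3 * B * K * (d / a) := by
    rw [ha, hR]; field_simp; ring
  rw [hfinal]
  have hare : a ≤ re := by
    have : R ≤ r := div_le_self hr.le (by linarith)
    linarith
  have haL : 12 * a * L ≤ pm - 1 := by
    have h1 : 12 * re * L ≤ (pm - 1) * ct := by
      have : (pm - 1) * (12 * re * L / (pm - 1)) = 12 * re * L := by field_simp
      rw [hct]
      linarith
    have h2 : 12 * R * L ≤ pm - 1 := by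
      rw [hR, ← mul_div_assoc, div_mul_eq_mul_div, div_le_iff₀ hct0]
      nlinarith
    have h3 : 0 ≤ 12 * R * L := by positivity
    rw [ha]
    linarith
  rcases le_or_gt a d with hda | hda
  · have h1 : u x ≤ M := huM x ⟨hx.1, ball_subset_ball (by linarith) hx.2⟩
    have h2 : 1 ≤ d / a := (one_le_div ha0).2 hda
    calc u x ≤ M := h1
      _ ≤ 3 * B * 1 * 1 := by rw [hB]; linarith [le_abs_self M, abs_nonneg M]
      _ ≤ 3 * B * K * (d / a) := by gcongr
  obtain ⟨Kp, hKp⟩ := hp.lipschitz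
  obtain ⟨p₁, p₂, hp₁, hp12⟩ := hp.bounded
  have hlow : ∀ᵐ y ∂(volume.restrict Ω), pm ≤ p y := by
    -- The real `essInf` is a lower bound a.e. only once `p` is known to be essentially bounded
    -- below.
    have hbd : Filter.IsBoundedUnder (· ≥ ·) (ae (volume.restrict Ω)) p :=
      ⟨p₁, by rw [Filter.eventually_map]; filter_upwards [hp12] with y hy using hy.1⟩
    filter_upwards [ae_essInf_le hbd] with y hy using hpmin.trans hy
  have hpΩ : ∀ y ∈ Ω, p y ∈ Set.Icc pm p₂ :=
    VarExp.forall_mem_of_ae_restrict hΩo hKp.continuousOn isClosed_Icc (by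
      filter_upwards [hlow, hp12] with y h1 h2 using ⟨h1, h2.2⟩)
  have hgradΩ : ∀ᵐ y, y ∈ Ω → ‖gradient p y‖ ≤ L := by
    rw [← ae_restrict_iff' hΩo.measurableSet]
    filter_upwards [enorm_ae_le_eLpNormEssSup (fun y => gradient p y) (volume.restrict Ω)] with y hy
    rw [VarExp.gradNorm, eLpNorm_exponent_top] at hgrad
    have := hy.trans hgrad
    rwa [← ofReal_norm, ENNReal.ofReal_le_ofReal_iff hL] at this
  obtain ⟨ζ, hζ, hζd⟩ := isClosed_frontier.exists_infDist_eq_dist ⟨w, hw⟩ x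
  obtain ⟨η, hζη, hη⟩ := hext.exists_ball ha0 hare hζ
  have hxζ : dist x ζ = d := hζd.symm
  -- The distance to `w` is at most `2a + a + d + R < R + 4a`, below `2R` because `a = R / 16`.
  have hball : closedBall η (2 * a) ⊆ ball w (2 * R) := by
    intro y hy
    rw [mem_closedBall] at hy
    have h1 : dist x w < R := hx.2
    rw [mem_ball]
    linarith [dist_triangle y η w, dist_triangle η ζ w, dist_triangle ζ x w, dist_comm η ζ,
      dist_comm ζ x]
  refine VarExp.le_of_tangent_ball (M := M) (by omega) hΩo hKp hpm hpΩ hgradΩ hu.weakSolution huc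
    hu0 ha0 hare hL haL ?_ hB0 hK1 hKT (hball.trans (ball_subset_ball h2r.le))
    (fun y hy => huM y ⟨hy.1, hball hy.2⟩) hη hx.1 hd0 hda ?_
  · rw [hB]; linarith [le_abs_self M]
  · linarith [dist_triangle x ζ η]
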